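/- Let $M$ be a smooth manifold of dimension $d\ge 3$, $g$ a Riemannian metric on $M$, $f\in C^\infty(M)$ a positive function, $m\in[0,\infty)$ and $\mu\in\mathbb{R}$. Set $$\mathrm{Ric}_\phi^m=\mathrm{Ric}-\tfrac{m}{f}\nabla^2f,\qquad R_\phi^m=R-\tfrac{2m}{f}\Delta f-\tfrac{m(m-1)}{f^2}(|\nabla f|^2-\mu),$$ $$J_\phi^m=\tfrac{1}{2(d+m-1)}R_\phi^m,\qquad P_\phi^m=\tfrac{1}{d+m-2}(\mathrm{Ric}_\phi^m-J_\phi^m g),$$ $$A_\phi^m=\mathrm{Rm}-P_\phi^m\wedge g,\qquad dP_\phi^m(x,y,z)=\nabla_xP_\phi^m(y,z)-\nabla_yP_\phi^m(x,z),$$ where $(h\wedge k)(x,y,z,w)=h(x,z)k(y,w)+h(y,w)k(x,z)-h(x,w)k(y,z)-h(y,z)k(x,w)$ and $\mathrm{Rm}(x,y,x,y)>0$ on the round sphere for linearly independent $x,y$. Assume that $(M,g,f,m,\mu)$ is locally conformally flat in the weighted sense, i.e. $d+m\in\{1,2\}$; or $d+m=3$ and $dP_\phi^m=0$; or $d+m\notin\{1,2,3\}$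 and $A_\phi^m=0$. For $\rho\in\mathbb{R}$ let $$(g_\rho)_{ij}=g_{ij}+2\rho (P_\phi^m)_{ij}+\rho^2 (P_\phi^m)_{ik}(P_\phi^m)_j^{\,k},\qquad U^i_j=\delta^i_j+\rho (P_\phi^m)^i_j .$$ Then: 1. On the open set of all $(t,x,\rho)\in(0,\infty)\times M\times\mathbb{R}$ such that $g_\rho$ is nondegenerate at $x$, the tensor $$\widetilde g=2\rho\,dt^2+2t\,d\rho\,dt+t^2g_\rho$$ is a smooth (nondegenerate) pseudo-Riemannian metric, and it is flat: its Riemann curvature tensor vanishes. 2. Wherever $g_\rho$ is nondegenerate, $U$ is invertible, and with $V=U^{-1}$ the Levi-Civita connections and the curvature tensors of $g_\rho$ and $g$ are related by $${}^{g_\rho}\nabla_i\eta_j={}^{g}\nabla_i\eta_j-\rho\,V^k_l\,(P_\phi^m)^l_{i;j}\,\eta_k\ \text{ for every one-form }\eta,\qquad {}^{g_\rho}R_{ijkl}={}^{g}R_{abkl}\,U^a_iU^b_j .$$ -/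

import Mathlib

open scoped Manifold ContDiff

set_option maxSynthPendingDepth 3

noncomputable section

namespace WeightedAmbient

/-! ### Pseudo-Riemannian geometry in a coordinate domain

`E` is the coordinate space. A field of bilinear forms is a map `G : E → E →L[ℝ] E →L[ℝ] ℝ`, and all
tensors are given by their coordinate expressions. -/

section Local

variable {E : Type*} [NormedAddCommGroup E] [NormedSpace ℝ E]

/-- The Christoffel symbols of the first kind of `G`:
`(v, w, z) ↦ (∂_v G(w, z) + ∂_w G(v, z) - ∂_z G(v, w)) / 2`. -/
def christoffelFirst (G : E → E →L[ℝ] E →L[ℝ] ℝ) (x : E) : E →L[ℝ] E →L[ℝ] E →L[ℝ] ℝ :=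
  let T : E →L[ℝ] E →L[ℝ] E →L[ℝ] ℝ := fderiv ℝ G x
  let K : E →L[ℝ] E →L[ℝ] E →L[ℝ] ℝ :=
    (ContinuousLinearMap.flipₗᵢ ℝ E E ℝ).toContinuousLinearEquiv.toContinuousLinearMap ∘L T.flip
  (1 / 2 : ℝ) • (T + T.flip - K)

theorem christoffelFirst_apply (G : E → E →L[ℝ] E →L[ℝ] ℝ) (x v w z : E) :
    christoffelFirst G x v w z
      = (fderiv ℝ G x v w z + fderiv ℝ G x w v z - fderiv ℝ G x z v w) / 2 := by
  simp [christoffelFirst]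
  ring

/-- The Christoffel symbols `Γ(v, w)` of the second kind, i.e. the Levi-Civita connection of `G` is
`∇_v W = ∂_v W + Γ(v, W)`. Here `(G x).inverse` raises an index. -/
def christoffel (G : E → E →L[ℝ] E →L[ℝ] ℝ) (x : E) : E →L[ℝ] E →L[ℝ] E :=
  (ContinuousLinearMap.compL ℝ E (E →L[ℝ] ℝ) E (G x).inverse) ∘L christoffelFirst G x

theorem christoffel_apply (G : E → E →L[ℝ] E →L[ℝ] ℝ) (x v w : E) :
    christoffel G x v w = (G x).inverse (christoffelFirst G x v w) := rfl

/-- The composition `(v, w) ↦ (z ↦ Γ(v, Γ(w, z)))`. -/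
def christoffelSq (G : E → E →L[ℝ] E →L[ℝ] ℝ) (x : E) : E →L[ℝ] E →L[ℝ] E →L[ℝ] E :=
  (ContinuousLinearMap.compL ℝ E E E).bilinearComp (christoffel G x) (christoffel G x)

/-- The Riemann curvature operator `R(u, v) w = ∇_u ∇_v w - ∇_v ∇_u w - ∇_{[u, v]} w`. -/
def curvature (G : E → E →L[ℝ] E →L[ℝ] ℝ) (x : E) : E →L[ℝ] E →L[ℝ] E →L[ℝ] E :=
  fderiv ℝ (christoffel G) x - (fderiv ℝ (christoffel G) x).flip
    + (christoffelSq G x - (christoffelSq G x).flip)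

theorem curvature_apply (G : E → E →L[ℝ] E →L[ℝ] ℝ) (x u v w : E) :
    curvature G x u v w
      = fderiv ℝ (christoffel G) x u v w - fderiv ℝ (christoffel G) x v u w
        + (christoffel G x u (christoffel G x v w) - christoffel G x v (christoffel G x u w)) :=
  rfl

/-- The Riemann curvature tensor `Rm(x, y, z, w) = G(R(x, y) w, z)`, so that `Rm(x, y, x, y) > 0` on
the round sphere for linearly independent `x`, `y`. -/
def Rm (G : E → E →L[ℝ] E →L[ℝ] ℝ) (p x y z w : E) : ℝ :=
  G p (curvature G p x y w) z

/-- The Levi-Civita covariant derivative of a one-form `η`: `(∇_v η)(w)`. -/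
def covDerivForm (G : E → E →L[ℝ] E →L[ℝ] ℝ) (η : E → E →L[ℝ] ℝ) (x v w : E) : ℝ :=
  fderiv ℝ η x v w - η x (christoffel G x v w)

/-- The Levi-Civita covariant derivative `∇_u B` of a field `B` of bilinear forms. -/
def covDerivBilin (G B : E → E →L[ℝ] E →L[ℝ] ℝ) (x u : E) : E →L[ℝ] E →L[ℝ] ℝ :=
  fderiv ℝ B x u
    - (B x).bilinearComp (christoffel G x u) (ContinuousLinearMap.id ℝ E)
    - (B x).bilinearComp (ContinuousLinearMap.id ℝ E) (christoffel G x u)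

/-- The Hessian `∇² f`. -/
def hess (G : E → E →L[ℝ] E →L[ℝ] ℝ) (f : E → ℝ) (x : E) : E →L[ℝ] E →L[ℝ] ℝ :=
  fderiv ℝ (fderiv ℝ f) x
    - (ContinuousLinearMap.compL ℝ E E ℝ (fderiv ℝ f x)) ∘L christoffel G x

/-- `|∇ f|²`. -/
def gradNormSq (G : E → E →L[ℝ] E →L[ℝ] ℝ) (f : E → ℝ) (x : E) : ℝ :=
  fderiv ℝ f x ((G x).inverse (fderiv ℝ f x))

/-- The endomorphism `B^♯` with `G(B^♯ v, w) = B(v, w)`. -/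
def sharp (G B : E → E →L[ℝ] E →L[ℝ] ℝ) (x : E) : E →L[ℝ] E :=
  (G x).inverse ∘L B x

/-- The metric trace `tr_G B = G^{ij} B_{ij}`. -/
def trG (G B : E → E →L[ℝ] E →L[ℝ] ℝ) (x : E) : ℝ :=
  LinearMap.trace ℝ E (sharp G B x : E →ₗ[ℝ] E)

/-- A field `G` of bilinear forms is a flat pseudo-Riemannian metric on the open set `S`: it is
smooth, symmetric and nondegenerate there, and its curvature vanishes. -/
def IsFlatMetricOn (G : E → E →L[ℝ] E →L[ℝ] ℝ) (S : Set E) : Prop :=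
  IsOpen S ∧ ContDiffOn ℝ ∞ G S ∧
    ∀ x ∈ S, (∀ v w, G x v w = G x w v) ∧ (G x).IsInvertible ∧
      ∀ u v w z, Rm G x u v w z = 0

variable [FiniteDimensional ℝ E]

/-- The trace of an endomorphism as a continuous linear functional. -/
def traceCLM : (E →L[ℝ] E) →L[ℝ] ℝ :=
  LinearMap.toContinuousLinearMap
    ((LinearMap.trace ℝ E) ∘ₗ
      (ContinuousLinearMap.coeLM ℝ : (E →L[ℝ] E) →ₗ[ℝ] (E →ₗ[ℝ] E)))

theorem traceCLM_apply (A : E →L[ℝ] E) :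
    traceCLM A = LinearMap.trace ℝ E (A : E →ₗ[ℝ] E) := rfl

/-- The Ricci tensor: `Ric(v, w)` is the trace of `u ↦ R(u, v) w`. -/
def ricci (G : E → E →L[ℝ] E →L[ℝ] ℝ) (x : E) : E →L[ℝ] E →L[ℝ] ℝ :=
  (ContinuousLinearMap.compL ℝ E (E →L[ℝ] E) ℝ traceCLM) ∘L
    ((ContinuousLinearMap.flipₗᵢ ℝ E E E).toContinuousLinearEquiv.toContinuousLinearMap ∘L
      (curvature G x).flip)

theorem ricci_apply (G : E → E →L[ℝ] E →L[ℝ] ℝ) (x v w : E) :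
    ricci G x v w
      = LinearMap.trace ℝ E (((curvature G x).flip v).flip w : E →ₗ[ℝ] E) := rfl

/-! ### Weighted curvatures -/

/-- The Bakry-Émery Ricci tensor `Ric_φ^m = Ric - (m / f) ∇² f`. -/
def weightedRicci (G : E → E →L[ℝ] E →L[ℝ] ℝ) (f : E → ℝ) (m : ℝ) (x : E) :
    E →L[ℝ] E →L[ℝ] ℝ :=
  ricci G x - (m / f x) • hess G f x

/-- The weighted scalar curvature
`R_φ^m = R - (2 m / f) Δ f - (m (m - 1) / f²) (|∇ f|² - μ)`. -/
def weightedScalar (G : E → E →L[ℝ] E →L[ℝ] ℝ) (f : E → ℝ) (m μ : ℝ) (x : E) : ℝ :=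
  trG G (ricci G) x - 2 * m / f x * trG G (hess G f) x
    - m * (m - 1) / f x ^ 2 * (gradNormSq G f x - μ)

/-- The weighted Schouten scalar `J_φ^m = R_φ^m / (2 (d + m - 1))`, where `d = dim E`. -/
def schoutenScalar (G : E → E →L[ℝ] E →L[ℝ] ℝ) (f : E → ℝ) (m μ : ℝ) (x : E) : ℝ :=
  1 / (2 * ((Module.finrank ℝ E : ℝ) + m - 1)) * weightedScalar G f m μ x

/-- The weighted Schouten tensor `P_φ^m = (Ric_φ^m - J_φ^m G) / (d + m - 2)`. -/
def schouten (G : E → E →L[ℝ] E →L[ℝ] ℝ) (f : E → ℝ) (m μ : ℝ) (x : E) :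
    E →L[ℝ] E →L[ℝ] ℝ :=
  (1 / ((Module.finrank ℝ E : ℝ) + m - 2)) •
    (weightedRicci G f m x - schoutenScalar G f m μ x • G x)

/-- The Kulkarni-Nomizu product of two bilinear forms. -/
def kulkarniNomizu (h k : E →L[ℝ] E →L[ℝ] ℝ) (x y z w : E) : ℝ :=
  h x z * k y w + h y w * k x z - h x w * k y z - h y z * k x w

/-- The weighted Weyl tensor `A_φ^m = Rm - P_φ^m ∧ G`. -/
def weightedWeyl (G : E → E →L[ℝ] E →L[ℝ] ℝ) (f : E → ℝ) (m μ : ℝ) (p x y z w : E) : ℝ :=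
  Rm G p x y z w - kulkarniNomizu (schouten G f m μ p) (G p) x y z w

/-- The weighted Cotton tensor `dP_φ^m(x, y, z) = ∇_x P_φ^m(y, z) - ∇_y P_φ^m(x, z)`. -/
def weightedCotton (G : E → E →L[ℝ] E →L[ℝ] ℝ) (f : E → ℝ) (m μ : ℝ) (p x y z : E) : ℝ :=
  covDerivBilin G (schouten G f m μ) p x y z - covDerivBilin G (schouten G f m μ) p y x z

/-! ### The family `g_ρ` and the metric `g̃` -/

/-- The endomorphism `U = I + ρ P_φ^m`, that is `U^i_j = δ^i_j + ρ (P_φ^m)^i_j`. -/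
def U (G : E → E →L[ℝ] E →L[ℝ] ℝ) (f : E → ℝ) (m μ ρ : ℝ) (x : E) : E →L[ℝ] E :=
  ContinuousLinearMap.id ℝ E + ρ • sharp G (schouten G f m μ) x

/-- `g_ρ = g + 2 ρ P_φ^m + ρ² (P_φ^m)²`, where `(P²)_{ij} = P_{ik} P_j^k`. -/
def gRho (G : E → E →L[ℝ] E →L[ℝ] ℝ) (f : E → ℝ) (m μ ρ : ℝ) (x : E) :
    E →L[ℝ] E →L[ℝ] ℝ :=
  G x + (2 * ρ) • schouten G f m μ x
    + ρ ^ 2 • (schouten G f m μ x).bilinearComp (ContinuousLinearMap.id ℝ E)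
        (sharp G (schouten G f m μ) x)

/-- The differential `dt` on `ℝ × E × ℝ`, whose points are written `(t, x, ρ)`. -/
def dt : (ℝ × E × ℝ) →L[ℝ] ℝ := ContinuousLinearMap.fst ℝ ℝ (E × ℝ)

/-- The differential `dx` on `ℝ × E × ℝ`. -/
def dx : (ℝ × E × ℝ) →L[ℝ] E :=
  ContinuousLinearMap.fst ℝ E ℝ ∘L ContinuousLinearMap.snd ℝ ℝ (E × ℝ)

/-- The differential `dρ` on `ℝ × E × ℝ`. -/
def dρ : (ℝ × E × ℝ) →L[ℝ] ℝ :=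
  ContinuousLinearMap.snd ℝ E ℝ ∘L ContinuousLinearMap.snd ℝ ℝ (E × ℝ)

/-- The metric `g̃ = 2 ρ dt² + 2 t dρ dt + t² g_ρ` in the coordinates `(t, x, ρ)`, where
`2 dρ dt = dt ⊗ dρ + dρ ⊗ dt`. -/
def ambientMetric (G : E → E →L[ℝ] E →L[ℝ] ℝ) (f : E → ℝ) (m μ : ℝ) (q : ℝ × E × ℝ) :
    (ℝ × E × ℝ) →L[ℝ] (ℝ × E × ℝ) →L[ℝ] ℝ :=
  (2 * q.2.2) • (dt (E := E)).smulRight (dt (E := E))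
    + q.1 • ((dt (E := E)).smulRight (dρ (E := E)) + (dρ (E := E)).smulRight (dt (E := E)))
    + q.1 ^ 2 • (gRho G f m μ q.2.2 q.2.1).bilinearComp dx dx

theorem ambientMetric_apply (G : E → E →L[ℝ] E →L[ℝ] ℝ) (f : E → ℝ) (m μ t ρ : ℝ) (x : E)
    (a a' b b' : ℝ) (v v' : E) :
    ambientMetric G f m μ (t, x, ρ) (a, v, b) (a', v', b')
      = 2 * ρ * (a * a') + t * (a * b' + b * a') + t ^ 2 * gRho G f m μ ρ x v v' := by
  simp [ambientMetric, dt, dρ, dx]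
  ring

end Local

/-! ### Smooth metric measure spaces -/

section Manifold

variable {d : ℕ} {M : Type*} [TopologicalSpace M] [ChartedSpace (EuclideanSpace ℝ (Fin d)) M]
  [IsManifold (𝓡 d) ∞ M]

/-- A smooth metric measure space structure `(g, f, m, μ)` on the smooth `d`-manifold `M`, with
finite dimensional parameter `m`. -/
structure SmoothMetricMeasure (d : ℕ) (M : Type*) [TopologicalSpace M]
    [ChartedSpace (EuclideanSpace ℝ (Fin d)) M] [IsManifold (𝓡 d) ∞ M] where
  /-- The Riemannian metric. -/
  g : Bundle.ContMDiffRiemannianMetric (𝓡 d) ∞ (EuclideanSpace ℝ (Fin d))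
    (fun x : M => TangentSpace (𝓡 d) x)
  /-- The density function. -/
  f : M → ℝ
  f_smooth : ContMDiff (𝓡 d) 𝓘(ℝ, ℝ) ∞ f
  f_pos : ∀ x, 0 < f x
  /-- The dimensional parameter. -/
  m : ℝ
  m_nonneg : 0 ≤ m
  /-- The curvature parameter. -/
  μ : ℝ

/-- The coordinate expression of the Riemannian metric in the chart `e`: its pullback under
`e.symm`. -/
def SmoothMetricMeasure.metricIn (S : SmoothMetricMeasure d M)
    (e : OpenPartialHomeomorph M (EuclideanSpace ℝ (Fin d))) (y : EuclideanSpace ℝ (Fin d)) :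
    EuclideanSpace ℝ (Fin d) →L[ℝ] EuclideanSpace ℝ (Fin d) →L[ℝ] ℝ :=
  let B : EuclideanSpace ℝ (Fin d) →L[ℝ] EuclideanSpace ℝ (Fin d) →L[ℝ] ℝ :=
    S.g.inner (e.symm y)
  let D : EuclideanSpace ℝ (Fin d) →L[ℝ] EuclideanSpace ℝ (Fin d) :=
    mfderiv (𝓡 d) (𝓡 d) e.symm y
  B.bilinearComp D D

theorem SmoothMetricMeasure.metricIn_apply (S : SmoothMetricMeasure d M)
    (e : OpenPartialHomeomorph M (EuclideanSpace ℝ (Fin d))) (y v w : EuclideanSpace ℝ (Fin d)) :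
    S.metricIn e y v w = S.g.inner (e.symm y) (mfderiv (𝓡 d) (𝓡 d) e.symm y v)
      (mfderiv (𝓡 d) (𝓡 d) e.symm y w) := rfl

/-- The coordinate expression of the density function in the chart `e`. -/
def SmoothMetricMeasure.densityIn (S : SmoothMetricMeasure d M)
    (e : OpenPartialHomeomorph M (EuclideanSpace ℝ (Fin d))) (y : EuclideanSpace ℝ (Fin d)) : ℝ :=
  S.f (e.symm y)

/-- The weighted Weyl tensor vanishes, i.e. its components vanish in every smooth chart. -/
def SmoothMetricMeasure.WeylVanishes (S : SmoothMetricMeasure d M) : Prop :=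
  ∀ e ∈ IsManifold.maximalAtlas (𝓡 d) ∞ M, ∀ p ∈ e.target, ∀ x y z w,
    weightedWeyl (S.metricIn e) (S.densityIn e) S.m S.μ p x y z w = 0

/-- The weighted Cotton tensor vanishes, i.e. its components vanish in every smooth chart. -/
def SmoothMetricMeasure.CottonVanishes (S : SmoothMetricMeasure d M) : Prop :=
  ∀ e ∈ IsManifold.maximalAtlas (𝓡 d) ∞ M, ∀ p ∈ e.target, ∀ x y z,
    weightedCotton (S.metricIn e) (S.densityIn e) S.m S.μ p x y z = 0

/-- Local conformal flatness in the weighted sense. -/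
def SmoothMetricMeasure.IsLocallyConformallyFlat (S : SmoothMetricMeasure d M) : Prop :=
  ((d : ℝ) + S.m = 1 ∨ (d : ℝ) + S.m = 2) ∨
  ((d : ℝ) + S.m = 3 ∧ S.CottonVanishes) ∨
  ((d : ℝ) + S.m ≠ 1 ∧ (d : ℝ) + S.m ≠ 2 ∧ (d : ℝ) + S.m ≠ 3 ∧ S.WeylVanishes)

/-- The part of the domain of `g̃` lying over the chart `e`, in the chart `(t, e, ρ)` of
`(0, ∞) × M × ℝ`: all `(t, y, ρ)` with `t > 0`, `y` in the target of `e` and `g_ρ` nondegenerate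
at `y`. -/
def SmoothMetricMeasure.ambientDomainIn (S : SmoothMetricMeasure d M)
    (e : OpenPartialHomeomorph M (EuclideanSpace ℝ (Fin d))) :
    Set (ℝ × EuclideanSpace ℝ (Fin d) × ℝ) :=
  {q | 0 < q.1 ∧ q.2.1 ∈ e.target ∧
    (gRho (S.metricIn e) (S.densityIn e) S.m S.μ q.2.2 q.2.1).IsInvertible}

end Manifold

end WeightedAmbient

end

noncomputable section

namespace WeightedAmbient

open Filter Topology

/-! ### Connection forms -/

section Connection

variable {E F F' : Type*} [NormedAddCommGroup E] [NormedSpace ℝ E]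
  [NormedAddCommGroup F] [NormedSpace ℝ F] [NormedAddCommGroup F'] [NormedSpace ℝ F']

/-! Write P for the weighted Schouten tensor and Q for the endomorphism P^♯. Both metrics are
squares. One has g_ρ = g(U·, U·) with U = I + ρQ, and g̃ is the pull-back of the tractor metric 2στ
+ g(ξ, ξ) on ℝ ⊕ TM ⊕ ℝ under the coframe Φ = (dt, t U dx, ρ dt + t dρ). If a connection preserves
the fibre metric and an invertible coframe is torsion free for it, the coframe carries the
Levi-Civita connection of the pulled-back metric to that connection (`christoffel_of_frame`), hence
curvature to curvature (`curvForm_intertwine`).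

For U the connection is that of g, and torsion freeness is the Codazzi equation dP = 0; this relates
g_ρ to g. For Φ the connection is the tractor connection pulled back from M, and torsion freeness is
again the Codazzi equation. The tractor curvature is made of Rm - P ∧ g and dP, so it vanishes
(`curvForm_tractorConn`), and g̃ is flat.

It remains to obtain Rm = P ∧ g and dP = 0 from local conformal flatness (`structure_equations`). As
d ≥ 3 and m ≥ 0, the cases d + m = 1, 2 do not occur, and d + m = 3 means d = 3, m = 0; there Rm - P
∧ g is a trace-free algebraic curvature tensor in dimension three, hence zero. In the remaining case
Rm = P ∧ g is assumed, and the second Bianchi identity gives dP = 0 if d ≥ 4. If d = 3 and m > 0 it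
only makes dP trace free; the definition of P, rewritten as fP = -∇²f + κg and differentiated,
supplies the rest (`schouten_codazzi`). -/

theorem fderiv_clm_apply_const {f : E → F →L[ℝ] F'} {x : E} (hf : DifferentiableAt ℝ f x)
    (w : F) (u : E) : fderiv ℝ (fun y => f y w) x u = fderiv ℝ f x u w := by
  rw [(hf.hasFDerivAt.clm_apply (hasFDerivAt_const w x)).fderiv]
  simp

/-- The curvature `∂_u A(v) - ∂_v A(u) + [A(u), A(v)]` of the connection form `A`. -/
def curvForm (A : E → E →L[ℝ] F →L[ℝ] F) (x u v : E) (w : F) : F :=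
  fderiv ℝ A x u v w - fderiv ℝ A x v u w + (A x u (A x v w) - A x v (A x u w))

theorem curvature_eq_curvForm (G : E → E →L[ℝ] E →L[ℝ] ℝ) (x u v w : E) :
    curvature G x u v w = curvForm (christoffel G) x u v w := rfl

/-- A field of maps intertwining two connections intertwines their curvatures. -/
theorem curvForm_intertwine {Ψ : E → F →L[ℝ] F'} {A : E → E →L[ℝ] F →L[ℝ] F}
    {A' : E → E →L[ℝ] F' →L[ℝ] F'} {x : E} (hΨ : ContDiffAt ℝ 2 Ψ x)
    (hA : DifferentiableAt ℝ A x) (hA' : DifferentiableAt ℝ A' x)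
    (h : ∀ᶠ y in 𝓝 x, ∀ v w, Ψ y (A y v w) = fderiv ℝ Ψ y v w + A' y v (Ψ y w))
    (u v : E) (w : F) : Ψ x (curvForm A x u v w) = curvForm A' x u v (Ψ x w) := by
  have hΨ1 : DifferentiableAt ℝ Ψ x := hΨ.differentiableAt (by norm_num)
  have hΨ2 : DifferentiableAt ℝ (fderiv ℝ Ψ) x :=
    (hΨ.fderiv_right (m := 1) (by norm_num)).differentiableAt (by norm_num)
  -- Differentiate the intertwining relation along `u`. The second derivative of `Ψ` is symmetric
  -- and drops out on antisymmetrizing in `u`, `v`.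
  have key : ∀ u v, fderiv ℝ Ψ x u (A x v w) + Ψ x (fderiv ℝ A x u v w)
      = fderiv ℝ (fderiv ℝ Ψ) x u v w + (fderiv ℝ A' x u v (Ψ x w)
        + A' x v (fderiv ℝ Ψ x u w)) := by
    intro u v
    have e1 := hΨ1.hasFDerivAt.clm_apply ((hA.hasFDerivAt.clm_apply
      (hasFDerivAt_const v x)).clm_apply (hasFDerivAt_const w x))
    have e2 := ((hΨ2.hasFDerivAt.clm_apply (hasFDerivAt_const v x)).clm_apply
      (hasFDerivAt_const w x)).add ((hA'.hasFDerivAt.clm_apply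
      (hasFDerivAt_const v x)).clm_apply (hΨ1.hasFDerivAt.clm_apply (hasFDerivAt_const w x)))
    have e3 := e1.congr_of_eventuallyEq (f₁ := fun y => fderiv ℝ Ψ y v w + A' y v (Ψ y w))
      (h.mono fun y hy => (hy v w).symm)
    have := congrArg (fun L => L u) (e3.unique e2)
    simp at this
    rw [add_comm, this]
    abel
  have hsymm : fderiv ℝ (fderiv ℝ Ψ) x u v = fderiv ℝ (fderiv ℝ Ψ) x v u :=
    (hΨ.isSymmSndFDerivAt (by simp)).eq u v
  have h0 := h.self_of_nhds
  have k1 := key u v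
  have k2 := key v u
  have a1 := h0 u (A x v w)
  have a2 := h0 v (A x u w)
  have a3 := congrArg (A' x u) (h0 v w)
  have a4 := congrArg (A' x v) (h0 u w)
  simp only [map_add] at a3 a4
  rw [hsymm] at k1
  simp only [curvForm, map_add, map_sub]
  rw [a1, a2, a3, a4, eq_sub_of_add_eq' k1, eq_sub_of_add_eq' k2]
  abel

/-- The second Bianchi identity of a connection form. -/
theorem curvForm_bianchi {A : E → E →L[ℝ] F →L[ℝ] F} {x : E} (hA : ContDiffAt ℝ 2 A x)
    (u v w : E) (z : F) :
    (fderiv ℝ (fun y => curvForm A y v w z) x u + A x u (curvForm A x v w z)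
        - curvForm A x v w (A x u z))
      + (fderiv ℝ (fun y => curvForm A y w u z) x v + A x v (curvForm A x w u z)
        - curvForm A x w u (A x v z))
      + (fderiv ℝ (fun y => curvForm A y u v z) x w + A x w (curvForm A x u v z)
        - curvForm A x u v (A x w z)) = 0 := by
  have hA1 : DifferentiableAt ℝ A x := hA.differentiableAt (by norm_num)
  have hA2 : DifferentiableAt ℝ (fderiv ℝ A) x :=
    (hA.fderiv_right (m := 1) (by norm_num)).differentiableAt (by norm_num)
  have hsymm : ∀ u v, fderiv ℝ (fderiv ℝ A) x u v = fderiv ℝ (fderiv ℝ A) x v u :=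
    (hA.isSymmSndFDerivAt (by simp)).eq
  -- In the cyclic sum the second derivatives of `A` cancel by symmetry, and the remaining products
  -- cancel as in the Jacobi identity.
  have key : ∀ u v w, fderiv ℝ (fun y => curvForm A y v w z) x u
      = fderiv ℝ (fderiv ℝ A) x u v w z - fderiv ℝ (fderiv ℝ A) x u w v z
        + ((fderiv ℝ A x u v (A x w z) + A x v (fderiv ℝ A x u w z))
          - (fderiv ℝ A x u w (A x v z) + A x w (fderiv ℝ A x u v z))) := by
    intro u v w
    have e1 := fun v w => (hA2.hasFDerivAt.clm_apply (hasFDerivAt_const v x)).clm_apply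
      (hasFDerivAt_const w x) |>.clm_apply (hasFDerivAt_const z x)
    have e2 := fun v w => (hA1.hasFDerivAt.clm_apply (hasFDerivAt_const v x)).clm_apply
      ((hA1.hasFDerivAt.clm_apply (hasFDerivAt_const w x)).clm_apply (hasFDerivAt_const z x))
    have e3 := ((e1 v w).sub (e1 w v)).add ((e2 v w).sub (e2 w v))
    have e4 : HasFDerivAt (fun y => curvForm A y v w z) _ x := e3
    rw [e4.fderiv]
    simp
    abel
  rw [key, key, key, hsymm v u, hsymm w u, hsymm w v]
  simp only [curvForm, map_add, map_sub]
  abel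

end Connection

/-! ### The Levi-Civita connection -/

section LeviCivita

variable {E : Type*} [NormedAddCommGroup E] [NormedSpace ℝ E]

/-- `G` is a pseudo-Riemannian metric on the open set `Ω`. -/
structure IsMetricOn (G : E → E →L[ℝ] E →L[ℝ] ℝ) (Ω : Set E) : Prop where
  isOpen : IsOpen Ω
  contDiffOn : ContDiffOn ℝ ∞ G Ω
  symm : ∀ x ∈ Ω, ∀ v w, G x v w = G x w v
  inv : ∀ x ∈ Ω, (G x).IsInvertible

variable {G : E → E →L[ℝ] E →L[ℝ] ℝ} {Ω : Set E} {x : E}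

theorem _root_.ContinuousLinearMap.IsInvertible.apply_inverse {F F' : Type*}
    [NormedAddCommGroup F] [NormedSpace ℝ F] [NormedAddCommGroup F'] [NormedSpace ℝ F']
    {L : F →L[ℝ] F'} (h : L.IsInvertible) (y : F') : L (L.inverse y) = y := by
  obtain ⟨e, rfl⟩ := h
  simp

theorem _root_.ContinuousLinearMap.IsInvertible.inverse_apply {F F' : Type*}
    [NormedAddCommGroup F] [NormedSpace ℝ F] [NormedAddCommGroup F'] [NormedSpace ℝ F']
    {L : F →L[ℝ] F'} (h : L.IsInvertible) (y : F) : L.inverse (L y) = y := by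
  obtain ⟨e, rfl⟩ := h
  simp

theorem _root_.ContinuousLinearMap.IsInvertible.eq_of_forall_apply
    {B : E →L[ℝ] E →L[ℝ] ℝ} (h : B.IsInvertible) {v w : E} (hvw : ∀ z, B v z = B w z) :
    v = w := by
  rw [← h.inverse_apply v, ← h.inverse_apply w, ContinuousLinearMap.ext hvw]

theorem metric_christoffel (h : (G x).IsInvertible) (v w z : E) :
    G x (christoffel G x v w) z
      = (fderiv ℝ G x v w z + fderiv ℝ G x w v z - fderiv ℝ G x z v w) / 2 := by
  rw [christoffel_apply, h.apply_inverse, christoffelFirst_apply]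

namespace IsMetricOn

variable (hG : IsMetricOn G Ω) (hx : x ∈ Ω)
include hG hx

theorem mem_nhds : Ω ∈ 𝓝 x := hG.isOpen.mem_nhds hx

theorem contDiffAt : ContDiffAt ℝ ∞ G x := hG.contDiffOn.contDiffAt (hG.mem_nhds hx)

theorem differentiableAt : DifferentiableAt ℝ G x :=
  (hG.contDiffAt hx).differentiableAt (by simp)

theorem fderiv_symm (u v w : E) : fderiv ℝ G x u v w = fderiv ℝ G x u w v := by
  have hd := hG.differentiableAt hx
  have e1 := fun v w => (hd.hasFDerivAt.clm_apply (hasFDerivAt_const v x)).clm_apply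
      (hasFDerivAt_const w x)
  have e2 := (e1 v w).congr_of_eventuallyEq (f₁ := fun y => G y w v)
    (eventually_of_mem (hG.mem_nhds hx) fun y hy => (hG.symm y hy v w).symm)
  have := congrArg (fun L => L u) (e2.unique (e1 w v))
  simpa using this

theorem christoffel_symm (v w : E) : christoffel G x v w = christoffel G x w v := by
  refine (hG.inv x hx).eq_of_forall_apply fun z => ?_
  rw [metric_christoffel (hG.inv x hx), metric_christoffel (hG.inv x hx),
    hG.fderiv_symm hx z v w]
  ring

theorem fderiv_eq (u v w : E) : fderiv ℝ G x u v w
    = G x (christoffel G x u v) w + G x v (christoffel G x u w) := by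
  rw [hG.symm x hx v, metric_christoffel (hG.inv x hx), metric_christoffel (hG.inv x hx),
    hG.fderiv_symm hx u w v, hG.fderiv_symm hx v u w, hG.fderiv_symm hx w u v]
  ring

/-- Uniqueness of the Levi-Civita connection: inserting metric compatibility in the three terms of
the Koszul formula, symmetry of `Γ` leaves a single one. -/
theorem christoffel_eq {Γ : E → E → E} (hΓ : ∀ v w, Γ v w = Γ w v)
    (hm : ∀ u v w, fderiv ℝ G x u v w = G x (Γ u v) w + G x v (Γ u w)) (v w : E) :
    christoffel G x v w = Γ v w := by
  refine (hG.inv x hx).eq_of_forall_apply fun z => ?_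
  rw [metric_christoffel (hG.inv x hx), hm, hm, hm, hΓ w v, hΓ z v, hΓ z w,
    hG.symm x hx w (Γ v z), hG.symm x hx (Γ v z) w, hG.symm x hx v (Γ w z)]
  ring

/-- The Levi-Civita connection of `H(Φ ·, Φ ·)`, where `Φ` takes values in a bundle with a
connection `A` preserving the fibre metric `H` and `Φ` is torsion free. -/
theorem christoffel_of_frame {F : Type*} [NormedAddCommGroup F] [NormedSpace ℝ F]
    {H : E → F →L[ℝ] F →L[ℝ] ℝ} {A : E → E →L[ℝ] F →L[ℝ] F} {Φ : E → E →L[ℝ] F}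
    (hH : DifferentiableAt ℝ H x) (hΦ : DifferentiableAt ℝ Φ x) (hΦi : (Φ x).IsInvertible)
    (hGH : ∀ᶠ y in 𝓝 x, ∀ v w, G y v w = H y (Φ y v) (Φ y w))
    (hA : ∀ u a b, fderiv ℝ H x u a b = H x (A x u a) b + H x a (A x u b))
    (ht : ∀ u v, fderiv ℝ Φ x u v + A x u (Φ x v) = fderiv ℝ Φ x v u + A x v (Φ x u))
    (v w : E) : Φ x (christoffel G x v w) = fderiv ℝ Φ x v w + A x v (Φ x w) := by
  -- The candidate is the pull-back of `A` by `Φ`: it is symmetric by `ht` and preserves `G` by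
  -- `hA`.
  rw [hG.christoffel_eq hx (Γ := fun v w => (Φ x).inverse (fderiv ℝ Φ x v w + A x v (Φ x w)))
    (fun v w => by simp only [ht v w]) _ v w, hΦi.apply_inverse]
  intro u v w
  have hd := hG.differentiableAt hx
  have e1 := (hd.hasFDerivAt.clm_apply (hasFDerivAt_const v x)).clm_apply
      (hasFDerivAt_const w x)
  have e2 := (hH.hasFDerivAt.clm_apply (hΦ.hasFDerivAt.clm_apply
    (hasFDerivAt_const v x))).clm_apply (hΦ.hasFDerivAt.clm_apply (hasFDerivAt_const w x))
  have e3 := e2.congr_of_eventuallyEq (f₁ := fun y => G y v w) (hGH.mono fun y hy => hy v w)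
  have := congrArg (fun L => L u) (e1.unique e3)
  simp at this
  rw [this, hGH.self_of_nhds, hGH.self_of_nhds, hΦi.apply_inverse, hΦi.apply_inverse, hA]
  simp only [map_add, add_apply]
  ring

end IsMetricOn

end LeviCivita

/-! ### Smoothness -/

section Smooth

variable {E : Type*} [NormedAddCommGroup E] [NormedSpace ℝ E]

theorem contDiffAt_bilinearComp {X F F' K : Type*} [NormedAddCommGroup X] [NormedSpace ℝ X]
    [NormedAddCommGroup F] [NormedSpace ℝ F] [NormedAddCommGroup F'] [NormedSpace ℝ F']
    [NormedAddCommGroup K] [NormedSpace ℝ K] {n : WithTop ℕ∞} {x : X}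
    {B : X → F →L[ℝ] F →L[ℝ] K} {f g : X → F' →L[ℝ] F} (hB : ContDiffAt ℝ n B x)
    (hf : ContDiffAt ℝ n f x) (hg : ContDiffAt ℝ n g x) :
    ContDiffAt ℝ n (fun y => (B y).bilinearComp (f y) (g y)) x := by
  have h1 := (ContinuousLinearMap.flipₗᵢ ℝ F' F K).contDiff.contDiffAt.comp x (hB.clm_comp hf)
  have h2 := (ContinuousLinearMap.flipₗᵢ ℝ F' F' K).contDiff.contDiffAt.comp x (h1.clm_comp hg)
  exact h2

variable {G : E → E →L[ℝ] E →L[ℝ] ℝ} {Ω : Set E} {x : E}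

theorem contDiffAt_flip {X F F' K : Type*} [NormedAddCommGroup X] [NormedSpace ℝ X]
    [NormedAddCommGroup F] [NormedSpace ℝ F] [NormedAddCommGroup F'] [NormedSpace ℝ F']
    [NormedAddCommGroup K] [NormedSpace ℝ K] {n : WithTop ℕ∞} {x : X}
    {B : X → F →L[ℝ] F' →L[ℝ] K} (hB : ContDiffAt ℝ n B x) :
    ContDiffAt ℝ n (fun y => (B y).flip) x :=
  (ContinuousLinearMap.flipₗᵢ ℝ F F' K).contDiff.contDiffAt.comp x hB

theorem contDiffAt_fderiv {F : Type*} [NormedAddCommGroup F] [NormedSpace ℝ F] {f : E → F}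
    (hf : ContDiffAt ℝ ∞ f x) : ContDiffAt ℝ ∞ (fderiv ℝ f) x :=
  hf.fderiv_right (by simp)

theorem contDiffAt_inverse [CompleteSpace E] {B : E → E →L[ℝ] E →L[ℝ] ℝ}
    (hB : ContDiffAt ℝ ∞ B x) (h : (B x).IsInvertible) :
    ContDiffAt ℝ ∞ (fun y => (B y).inverse) x := by
  obtain ⟨e, he⟩ := h
  have := contDiffAt_map_inverse (𝕜 := ℝ) (n := ∞) e
  rw [he] at this
  exact this.comp x hB

theorem contDiffAt_christoffelFirst (hG : ContDiffAt ℝ ∞ G x) :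
    ContDiffAt ℝ ∞ (christoffelFirst G) x := by
  have h := contDiffAt_fderiv hG
  have h' := contDiffAt_flip h
  exact ContDiffAt.const_smul (1 / 2 : ℝ)
    ((h.add h').sub (ContDiffAt.clm_comp contDiffAt_const h'))

variable [CompleteSpace E]

theorem contDiffAt_christoffel (hG : ContDiffAt ℝ ∞ G x) (h : (G x).IsInvertible) :
    ContDiffAt ℝ ∞ (christoffel G) x := by
  have h1 := (ContinuousLinearMap.compL ℝ E (E →L[ℝ] ℝ) E).contDiff.contDiffAt.comp x
    (contDiffAt_inverse hG h)
  exact h1.clm_comp (contDiffAt_christoffelFirst hG)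

theorem contDiffAt_curvature (hG : ContDiffAt ℝ ∞ G x) (h : (G x).IsInvertible) :
    ContDiffAt ℝ ∞ (curvature G) x := by
  have h1 := contDiffAt_christoffel hG h
  have h2 : ContDiffAt ℝ ∞ (christoffelSq G) x :=
    contDiffAt_bilinearComp (B := fun _ => ContinuousLinearMap.compL ℝ E E E)
      contDiffAt_const h1 h1
  have h3 := contDiffAt_fderiv h1
  exact (h3.sub (contDiffAt_flip h3)).add (h2.sub (contDiffAt_flip h2))

theorem contDiffAt_hess {f : E → ℝ} (hG : ContDiffAt ℝ ∞ G x) (h : (G x).IsInvertible)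
    (hf : ContDiffAt ℝ ∞ f x) : ContDiffAt ℝ ∞ (hess G f) x := by
  have h1 := contDiffAt_fderiv hf
  refine (contDiffAt_fderiv h1).sub (ContDiffAt.clm_comp ?_ (contDiffAt_christoffel hG h))
  exact (ContinuousLinearMap.compL ℝ E E ℝ).contDiff.contDiffAt.comp x h1

theorem contDiffAt_sharp {B : E → E →L[ℝ] E →L[ℝ] ℝ} (hG : ContDiffAt ℝ ∞ G x)
    (h : (G x).IsInvertible) (hB : ContDiffAt ℝ ∞ B x) : ContDiffAt ℝ ∞ (sharp G B) x :=
  (contDiffAt_inverse hG h).clm_comp hB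

variable [FiniteDimensional ℝ E]

theorem contDiffAt_trG {B : E → E →L[ℝ] E →L[ℝ] ℝ} (hG : ContDiffAt ℝ ∞ G x)
    (h : (G x).IsInvertible) (hB : ContDiffAt ℝ ∞ B x) : ContDiffAt ℝ ∞ (trG G B) x :=
  (traceCLM (E := E)).contDiff.contDiffAt.comp x (contDiffAt_sharp hG h hB)

theorem contDiffAt_ricci (hG : ContDiffAt ℝ ∞ G x) (h : (G x).IsInvertible) :
    ContDiffAt ℝ ∞ (ricci G) x :=
  ContDiffAt.clm_comp contDiffAt_const
    (ContDiffAt.clm_comp contDiffAt_const (contDiffAt_flip (contDiffAt_curvature hG h)))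

theorem contDiffAt_schoutenScalar {f : E → ℝ} (m μ : ℝ) (hG : ContDiffAt ℝ ∞ G x)
    (h : (G x).IsInvertible) (hf : ContDiffAt ℝ ∞ f x) (hf0 : f x ≠ 0) :
    ContDiffAt ℝ ∞ (schoutenScalar G f m μ) x := by
  have h1 := contDiffAt_trG hG h (contDiffAt_ricci hG h)
  have h2 := contDiffAt_trG hG h (contDiffAt_hess hG h hf)
  have h3 : ContDiffAt ℝ ∞ (gradNormSq G f) x :=
    (contDiffAt_fderiv hf).clm_apply ((contDiffAt_inverse hG h).clm_apply (contDiffAt_fderiv hf))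
  exact contDiffAt_const.mul ((h1.sub ((contDiffAt_const.div hf hf0).mul h2)).sub
    ((contDiffAt_const.div (hf.pow 2) (pow_ne_zero 2 hf0)).mul (h3.sub contDiffAt_const)))

theorem contDiffAt_schouten {f : E → ℝ} (m μ : ℝ) (hG : ContDiffAt ℝ ∞ G x)
    (h : (G x).IsInvertible) (hf : ContDiffAt ℝ ∞ f x) (hf0 : f x ≠ 0) :
    ContDiffAt ℝ ∞ (schouten G f m μ) x :=
  ContDiffAt.const_smul (1 / ((Module.finrank ℝ E : ℝ) + m - 2))
    (((contDiffAt_ricci hG h).sub ((contDiffAt_const.div hf hf0).smul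
      (contDiffAt_hess hG h hf))).sub ((contDiffAt_schoutenScalar m μ hG h hf hf0).smul hG))

end Smooth

/-! ### Symmetries of the curvature tensor -/

section Symmetries

variable {E : Type*} [NormedAddCommGroup E] [NormedSpace ℝ E]
variable {G : E → E →L[ℝ] E →L[ℝ] ℝ} {Ω : Set E} {x : E}

theorem curvature_antisymm (G : E → E →L[ℝ] E →L[ℝ] ℝ) (x u v w : E) :
    curvature G x u v w = - curvature G x v u w := by
  simp only [curvature_apply]
  abel

variable [CompleteSpace E]

namespace IsMetricOn

variable (hG : IsMetricOn G Ω) (hx : x ∈ Ω)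
include hG hx

theorem contDiffAt_christoffel : ContDiffAt ℝ ∞ (christoffel G) x :=
  WeightedAmbient.contDiffAt_christoffel (hG.contDiffAt hx) (hG.inv x hx)

theorem differentiableAt_christoffel : DifferentiableAt ℝ (christoffel G) x :=
  (hG.contDiffAt_christoffel hx).differentiableAt (by simp)

theorem fderiv_christoffel_symm (u v w : E) :
    fderiv ℝ (christoffel G) x u v w = fderiv ℝ (christoffel G) x u w v := by
  have hd := hG.differentiableAt_christoffel hx
  have e1 := fun v w => (hd.hasFDerivAt.clm_apply (hasFDerivAt_const v x)).clm_apply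
      (hasFDerivAt_const w x)
  have e2 := (e1 v w).congr_of_eventuallyEq (f₁ := fun y => christoffel G y w v)
    (eventually_of_mem (hG.mem_nhds hx) fun y hy => (hG.christoffel_symm hy v w).symm)
  have := congrArg (fun L => L u) (e2.unique (e1 w v))
  simpa using this

theorem curvature_bianchi (u v w : E) :
    curvature G x u v w + curvature G x v w u + curvature G x w u v = 0 := by
  simp only [curvature_apply]
  rw [hG.fderiv_christoffel_symm hx u w v, hG.fderiv_christoffel_symm hx v w u,
    hG.fderiv_christoffel_symm hx w v u, hG.christoffel_symm hx w v,
    hG.christoffel_symm hx w u, hG.christoffel_symm hx v u]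
  abel

/-- Since `∇G = 0`, lowering an index intertwines `Γ` with the dual connection `A'` on covectors,
whose curvature is minus the transpose of that of `Γ`. -/
theorem curvature_skew (u v w z : E) :
    G x (curvature G x u v w) z = - G x (curvature G x u v z) w := by
  let Λ : (E →L[ℝ] E) →L[ℝ] (E →L[ℝ] ℝ) →L[ℝ] (E →L[ℝ] ℝ) :=
    - (ContinuousLinearMap.compL ℝ E E ℝ).flip
  let A' : E → E →L[ℝ] (E →L[ℝ] ℝ) →L[ℝ] (E →L[ℝ] ℝ) := fun y => Λ ∘L christoffel G y
  have hd := hG.differentiableAt_christoffel hx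
  have hA' : HasFDerivAt A' _ x := (hasFDerivAt_const Λ x).clm_comp hd.hasFDerivAt
  have hi := curvForm_intertwine (Ψ := G) (A := christoffel G) (A' := A')
    ((hG.contDiffAt hx).of_le (WithTop.coe_le_coe.2 (le_top : (2 : ℕ∞) ≤ ⊤))) hd hA'.differentiableAt
    (eventually_of_mem (hG.mem_nhds hx) fun y hy v w => by
      ext z
      simp [A', Λ, hG.fderiv_eq hy v w z]) u v w
  have := congrArg (fun L => L z) hi
  simp only [← curvature_eq_curvForm] at this
  rw [this, hG.symm x hx _ w]
  simp only [curvForm, hA'.fderiv, curvature_apply]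
  simp [A', Λ]
  ring

/-- The pair symmetry of the Riemann tensor. -/
theorem Rm_pair_symm (u v w z : E) : Rm G x u v w z = Rm G x w z u v := by
  have b : ∀ u v w z, Rm G x u v z w + Rm G x v w z u + Rm G x w u z v = 0 := by
    intro u v w z
    have := congrArg (fun t => G x t z) (hG.curvature_bianchi hx u v w)
    simpa [Rm] using this
  have a : ∀ u v w z, Rm G x u v w z = - Rm G x v u w z := by
    intro u v w z
    simp [Rm, curvature_antisymm G x u v z]
  have s : ∀ u v w z, Rm G x u v w z = - Rm G x u v z w := fun u v w z =>
    hG.curvature_skew hx u v z w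
  -- Pair symmetry is a linear consequence of four cyclic identities and the two antisymmetries.
  linarith [b u v w z, b v w z u, b w z u v, b z u v w, a u v w z, a w u z v, s u v w z, s v w u z,
    a v w z u, s w z u v, s w u z v, a w z v u, s z u v w, a z u v w, s v z u w, a v z u w, s u w v z,
    s z v u w, a z v u w, a u w z v, s z u w v, s w z v u, s u v z w, s v w z u, a z u w v, s u w z v,
    a u w v z, a w u v z, s w u v z, a v z w u, a u z v w, a v w u z, a w v u z]

end IsMetricOn

end Symmetries

/-! ### Algebra of traces -/

section Trace

variable {E : Type*} [NormedAddCommGroup E] [NormedSpace ℝ E] [FiniteDimensional ℝ E]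

theorem traceCLM_id : traceCLM (ContinuousLinearMap.id ℝ E) = Module.finrank ℝ E :=
  LinearMap.trace_id ℝ E

theorem traceCLM_smulRight (φ : E →L[ℝ] ℝ) (ξ : E) : traceCLM (φ.smulRight ξ) = φ ξ :=
  LinearMap.trace_smulRight (φ : E →ₗ[ℝ] ℝ) ξ

variable {g : E →L[ℝ] E →L[ℝ] ℝ}

/-- A nondegenerate symmetric form has an orthogonal basis of non-null vectors. -/
theorem exists_orthogonal_basis (hs : ∀ v w, g v w = g w v) (hg : g.IsInvertible) :
    ∃ b : Module.Basis (Fin (Module.finrank ℝ E)) ℝ E,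
      (∀ i j, i ≠ j → g (b i) (b j) = 0) ∧ ∀ i, g (b i) (b i) ≠ 0 := by
  have : Invertible (2 : ℝ) := invertibleOfNonzero two_ne_zero
  obtain ⟨b, hb⟩ := LinearMap.BilinForm.exists_orthogonal_basis
    (B := ContinuousLinearMap.toLinearMap₁₂ g) ⟨fun v w => hs v w⟩
  refine ⟨b, fun i j hij => hb hij, fun i => hb.not_isOrtho_basis_self_of_separatingLeft ?_ i⟩
  intro v hv
  exact hg.eq_of_forall_apply (w := 0) fun z => by simpa using hv z

theorem traceCLM_eq_sum {ι : Type*} [Fintype ι] (b : Module.Basis ι ℝ E)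
    (h0 : ∀ i j, i ≠ j → g (b i) (b j) = 0) (h1 : ∀ i, g (b i) (b i) ≠ 0) (T : E →L[ℝ] E) :
    traceCLM T = ∑ i, g (T (b i)) (b i) / g (b i) (b i) := by
  classical
  rw [traceCLM_apply, LinearMap.trace_eq_matrix_trace ℝ b, Matrix.trace]
  refine Finset.sum_congr rfl fun i _ => ?_
  rw [Matrix.diag_apply, LinearMap.toMatrix_apply, eq_div_iff (h1 i)]
  have h2 : g (T (b i)) (b i) = g (∑ j, b.repr (T (b i)) j • b j) (b i) := by rw [b.sum_repr]
  rw [h2, map_sum, sum_apply, Finset.sum_eq_single i]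
  · simp
  · intro j _ hj
    simp [h0 j i hj]
  · simp

theorem traceCLM_eq_zero_of_skew (hs : ∀ v w, g v w = g w v) (hg : g.IsInvertible)
    {T : E →L[ℝ] E} (hT : ∀ v w, g (T v) w = - g (T w) v) : traceCLM T = 0 := by
  obtain ⟨b, h0, h1⟩ := exists_orthogonal_basis hs hg
  rw [traceCLM_eq_sum b h0 h1]
  refine Finset.sum_eq_zero fun i _ => ?_
  rw [div_eq_zero_iff]
  left
  linarith [hT (b i) (b i)]

/-- The curvature operator `(u, v) ↦ (w ↦ g(v, w) Q u + B(v, w) u - g(u, w) Q v - B(u, w) v)` of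
the Kulkarni-Nomizu product of `B` and `g`, where `Q` is the endomorphism of `B`. -/
def knOp (g B : E →L[ℝ] E →L[ℝ] ℝ) (Q : E →L[ℝ] E) : E →L[ℝ] E →L[ℝ] E →L[ℝ] E :=
  let S : E →L[ℝ] E →L[ℝ] E →L[ℝ] E :=
    (ContinuousLinearMap.smulRightL ℝ E E).bilinearComp g Q
      + (ContinuousLinearMap.smulRightL ℝ E E).bilinearComp B (ContinuousLinearMap.id ℝ E)
  S.flip - S

omit [FiniteDimensional ℝ E] in
theorem knOp_apply (g B : E →L[ℝ] E →L[ℝ] ℝ) (Q : E →L[ℝ] E) (u v w : E) :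
    knOp g B Q u v w = g v w • Q u + B v w • u - (g u w • Q v + B u w • v) := rfl

theorem trace_knOp {B : E →L[ℝ] E →L[ℝ] ℝ} {Q : E →L[ℝ] E} (hs : ∀ v w, g v w = g w v)
    (hBs : ∀ v w, B v w = B w v) (hQ : ∀ v w, g (Q v) w = B v w) (v w : E) :
    traceCLM (((knOp g B Q).flip v).flip w)
      = ((Module.finrank ℝ E : ℝ) - 2) * B v w + traceCLM Q * g v w := by
  have h : ((knOp g B Q).flip v).flip w = g v w • Q + B v w • ContinuousLinearMap.id ℝ E
      - ((g w).smulRight (Q v) + (B w).smulRight v) := by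
    ext u
    simp [knOp_apply, hs u w, hBs u w]
  rw [h, map_sub, map_add, map_add, map_smul, map_smul, traceCLM_id, traceCLM_smulRight,
    traceCLM_smulRight, hs w, hQ, hBs w v]
  simp only [smul_eq_mul]
  ring

/-- In dimension three a trace free algebraic curvature operator vanishes. -/
theorem curvatureLike_eq_zero_of_finrank_eq_three (hd : Module.finrank ℝ E = 3)
    (hs : ∀ v w, g v w = g w v) (hg : g.IsInvertible) {T : E →L[ℝ] E →L[ℝ] E →L[ℝ] E}
    (hT : ∀ u v w, T u v w = - T v u w) (hsk : ∀ u v w z, g (T u v w) z = - g (T u v z) w)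
    (htr : ∀ v w, traceCLM ((T.flip v).flip w) = 0) : T = 0 := by
  obtain ⟨b', h0', h1'⟩ := exists_orthogonal_basis hs hg
  obtain ⟨b, h0, h1⟩ : ∃ b : Module.Basis (Fin 3) ℝ E,
      (∀ i j, i ≠ j → g (b i) (b j) = 0) ∧ ∀ i, g (b i) (b i) ≠ 0 := by
    refine ⟨b'.reindex (finCongr hd), fun i j hij => ?_, fun i => ?_⟩
    · simpa using h0' _ _ (by simpa using hij)
    · simpa using h1' _
  have ha : ∀ i j k l, g (T (b i) (b j) (b k)) (b l) = - g (T (b j) (b i) (b k)) (b l) := by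
    intro i j k l
    rw [hT (b i)]
    simp
  have hb : ∀ i j k l, g (T (b i) (b j) (b k)) (b l) = - g (T (b i) (b j) (b l)) (b k) :=
    fun i j k l => hsk _ _ _ _
  have htr' : ∀ j k, ∑ i, g (T (b i) (b j) (b k)) (b i) / g (b i) (b i) = 0 := by
    intro j k
    rw [← htr (b j) (b k), traceCLM_eq_sum b h0 h1]
    rfl
  obtain ⟨r, hr⟩ : ∃ r : Fin 3 → Fin 3 → Fin 3 → Fin 3 → ℝ,
      r = fun i j k l => g (T (b i) (b j) (b k)) (b l) := ⟨_, rfl⟩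
  have hr' : ∀ i j k l, g (T (b i) (b j) (b k)) (b l) = r i j k l := fun i j k l => by rw [hr]
  simp only [hr'] at ha hb htr'
  have z1 : ∀ i k l, r i i k l = 0 := fun i k l => by linarith [ha i i k l]
  have z2 : ∀ i j k, r i j k k = 0 := fun i j k => by linarith [hb i j k k]
  have three : ∀ i j k : Fin 3, i ≠ j → k ≠ i → k ≠ j → ∀ l, l = i ∨ l = j ∨ l = k := by
    decide
  have off : ∀ i j k : Fin 3, i ≠ j → i ≠ k → j ≠ k → r i j k i = 0 := by
    intro i j k hij hik hjk
    have h := htr' j k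
    rw [Finset.sum_eq_single i, div_eq_zero_iff, or_iff_left (h1 i)] at h
    · exact h
    · intro l _ hl
      rcases three i j k hij hik.symm hjk.symm l with rfl | rfl | rfl
      · exact absurd rfl hl
      · rw [z1, zero_div]
      · rw [z2, zero_div]
    · simp
  simp only [Fin.sum_univ_three] at htr'
  have e0 := htr' 0 0
  have e1 := htr' 1 1
  have e2 := htr' 2 2
  simp only [z1, zero_div, zero_add, add_zero] at e0 e1 e2
  have s10 : r 1 0 0 1 = r 0 1 1 0 := by rw [ha, hb, neg_neg]
  have s20 : r 2 0 0 2 = r 0 2 2 0 := by rw [ha, hb, neg_neg]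
  have s21 : r 2 1 1 2 = r 1 2 2 1 := by rw [ha, hb, neg_neg]
  have n0 := h1 0
  have n1 := h1 1
  have n2 := h1 2
  rw [s10, s20] at e0
  rw [s21] at e1
  field_simp at e0 e1 e2
  -- The diagonal Ricci components are three linear equations in the three sectional components;
  -- this combination isolates one of them.
  have d01 : r 0 1 1 0 = 0 := by
    have : 2 * (g (b 2) (b 2) * r 0 1 1 0) = 0 := by linear_combination e0 + e1 - e2
    simpa [n2] using this
  have d02 : r 0 2 2 0 = 0 := by
    rw [d01] at e0
    simpa [n1] using e0
  have d12 : r 1 2 2 1 = 0 := by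
    rw [d01] at e1
    simpa [n0] using e1
  have diag : ∀ i j : Fin 3, r i j j i = 0 := by
    intro i j
    fin_cases i <;> fin_cases j <;> first
      | exact z1 _ _ _ | exact d01 | exact d02 | exact d12
      | exact s10.trans d01 | exact s20.trans d02 | exact s21.trans d12
  -- With only three index values, the antisymmetries reduce every component to one covered by
  -- `diag` or `off`.
  have main : ∀ i j k l, r i j k l = 0 := by
    intro i j k l
    by_cases hij : i = j
    · rw [hij, z1]
    by_cases hkl : k = l
    · rw [hkl, z2]
    by_cases hil : i = l
    · subst hil
      by_cases hjk : j = k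
      · rw [hjk, diag]
      · exact off i j k hij (Ne.symm hkl) hjk
    by_cases hjl : j = l
    · subst hjl
      rw [ha, neg_eq_zero]
      by_cases hik : i = k
      · rw [hik, diag]
      · exact off j i k (Ne.symm hij) (Ne.symm hkl) hik
    by_cases hik : i = k
    · subst hik
      rw [hb, neg_eq_zero]
      exact off i j l hij hil hjl
    by_cases hjk : j = k
    · subst hjk
      rw [ha, hb, neg_neg]
      exact off j i l (Ne.symm hij) hjl hil
    rcases three i j k hij (Ne.symm hik) (Ne.symm hjk) l with h | h | h
    · exact absurd h.symm hil
    · exact absurd h.symm hjl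
    · exact absurd h.symm hkl
  ext u v w
  have hz : ∀ u v w, T u v w = 0 := by
    have c : ∀ i j k, T (b i) (b j) (b k) = 0 := by
      intro i j k
      have : g (T (b i) (b j) (b k)) = 0 := by
        have : (g (T (b i) (b j) (b k)) : E →ₗ[ℝ] ℝ) = 0 :=
          b.ext fun l => by simpa [hr'] using main i j k l
        ext z
        exact congrArg (fun L => L z) this
      exact hg.eq_of_forall_apply (w := 0) fun z => by simp [this]
    intro u v w
    rw [← b.sum_repr u, ← b.sum_repr v, ← b.sum_repr w]
    simp only [map_sum, map_smul, sum_apply, smul_apply, c, smul_zero, Finset.sum_const_zero]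
  simp [hz]

/-- The traces of the second Bianchi identity of a Kulkarni-Nomizu product. -/
theorem cotton_of_bianchi (hs : ∀ v w, g v w = g w v) (hg : g.IsInvertible)
    {C : E →L[ℝ] E →L[ℝ] E} (hC : ∀ u v, C u v = - C v u)
    (hb : ∀ u v w z, g (C u v) z • w + g (C v w) z • u + g (C w u) z • v
      = g w z • C u v + g u z • C v w + g v z • C w u)
    (hd : 3 ≤ Module.finrank ℝ E) :
    (∀ u, traceCLM (C u) = 0) ∧
      ∀ u v, ((Module.finrank ℝ E : ℝ) - 3) • C u v = 0 := by
  -- Both sides of `hb` are read as endomorphisms in `w`, and their traces are compared.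
  have h1 : ∀ u v z, ((Module.finrank ℝ E : ℝ) - 3) * g (C u v) z
      = g u z * traceCLM (C v) - g v z * traceCLM (C u) := by
    intro u v z
    have h : g (C u v) z • ContinuousLinearMap.id ℝ E + ((g z) ∘L (C v)).smulRight u
        - ((g z) ∘L (C u)).smulRight v = (g z).smulRight (C u v) + g u z • C v - g v z • C u := by
      ext w
      have := hb u v w z
      rw [hC w u] at this
      simp only [map_neg, neg_apply] at this
      simp [hs z]
      linear_combination (norm := module) this
    have := congrArg traceCLM h
    simp only [map_add, map_sub, map_smul, traceCLM_id, traceCLM_smulRight, smul_eq_mul,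
      ContinuousLinearMap.comp_apply] at this
    rw [hC v u, map_neg, hs z] at this
    linarith
  have h2 : ∀ u v, ((Module.finrank ℝ E : ℝ) - 3) • C u v
      = traceCLM (C v) • u - traceCLM (C u) • v := by
    intro u v
    refine hg.eq_of_forall_apply fun z => ?_
    simp only [map_smul, map_sub, smul_apply, sub_apply, smul_eq_mul, h1]
    ring
  -- Tracing `h2` over `v` gives `(d - 3) t = t - d t` for `t = tr C(u)`, and `2 d - 4 ≠ 0`.
  have h3 : ∀ u, traceCLM (C u) = 0 := by
    intro u
    have h : ((Module.finrank ℝ E : ℝ) - 3) • C u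
        = (traceCLM ∘L C).smulRight u - traceCLM (C u) • ContinuousLinearMap.id ℝ E := by
      ext v
      simpa using h2 u v
    have := congrArg traceCLM h
    simp only [map_sub, map_smul, traceCLM_id, traceCLM_smulRight, smul_eq_mul,
      ContinuousLinearMap.comp_apply] at this
    have h4 : (2 * (Module.finrank ℝ E : ℝ) - 4) * traceCLM (C u) = 0 := by linarith
    have h5 : (3 : ℝ) ≤ Module.finrank ℝ E := by exact_mod_cast hd
    exact (mul_eq_zero.1 h4).resolve_left (by linarith)
  exact ⟨h3, fun u v => by rw [h2, h3, h3]; simp⟩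

end Trace

/-! ### Codazzi tensors and the second Bianchi identity -/

section Codazzi

variable {E : Type*} [NormedAddCommGroup E] [NormedSpace ℝ E]
variable {G B : E → E →L[ℝ] E →L[ℝ] ℝ} {Ω : Set E} {x : E}

theorem covDerivBilin_apply (G B : E → E →L[ℝ] E →L[ℝ] ℝ) (x u v w : E) :
    covDerivBilin G B x u v w = fderiv ℝ B x u v w - B x (christoffel G x u v) w
      - B x v (christoffel G x u w) := rfl

/-- The covariant derivative `(∇_u Q) v` of a field `Q` of endomorphisms. -/
def covDerivEnd (G : E → E →L[ℝ] E →L[ℝ] ℝ) (Q : E → E →L[ℝ] E) (x : E) :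
    E →L[ℝ] E →L[ℝ] E :=
  fderiv ℝ Q x + ((ContinuousLinearMap.compL ℝ E E E).flip (Q x)) ∘L christoffel G x
    - (ContinuousLinearMap.compL ℝ E E E (Q x)) ∘L christoffel G x

theorem covDerivEnd_apply (G : E → E →L[ℝ] E →L[ℝ] ℝ) (Q : E → E →L[ℝ] E) (x u v : E) :
    covDerivEnd G Q x u v
      = fderiv ℝ Q x u v + christoffel G x u (Q x v) - Q x (christoffel G x u v) := rfl

namespace IsMetricOn

variable (hG : IsMetricOn G Ω) (hx : x ∈ Ω)
include hG hx

theorem metric_sharp (v w : E) : G x (sharp G B x v) w = B x v w := by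
  rw [sharp, ContinuousLinearMap.comp_apply, (hG.inv x hx).apply_inverse]

theorem differentiableAt_sharp [CompleteSpace E] (hB : ContDiffAt ℝ ∞ B x) :
    DifferentiableAt ℝ (sharp G B) x :=
  (contDiffAt_sharp (hG.contDiffAt hx) (hG.inv x hx) hB).differentiableAt (by simp)

/-- Raising an index commutes with `∇` because `∇G = 0`. -/
theorem metric_covDerivEnd_sharp [CompleteSpace E] (hB : ContDiffAt ℝ ∞ B x) (u v w : E) :
    G x (covDerivEnd G (sharp G B) x u v) w = covDerivBilin G B x u v w := by
  have e1 := ((hG.differentiableAt hx).hasFDerivAt.clm_apply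
    ((hG.differentiableAt_sharp hx hB).hasFDerivAt.clm_apply
      (hasFDerivAt_const v x))).clm_apply (hasFDerivAt_const w x)
  have e2 := ((hB.differentiableAt (by simp)).hasFDerivAt.clm_apply
    (hasFDerivAt_const v x)).clm_apply (hasFDerivAt_const w x)
  have e3 := e1.congr_of_eventuallyEq (f₁ := fun y => B y v w)
    (eventually_of_mem (hG.mem_nhds hx) fun y hy => (hG.metric_sharp hy v w).symm)
  have := congrArg (fun L => L u) (e2.unique e3)
  simp at this
  rw [covDerivEnd_apply, covDerivBilin_apply, this, hG.fderiv_eq hx, map_sub, map_add,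
    sub_apply, add_apply, hG.metric_sharp hx, hG.metric_sharp hx]
  ring

variable [CompleteSpace E]

/-- The second Bianchi identity for a Riemann tensor that is a Kulkarni-Nomizu product. -/
theorem knOp_bianchi (hB : ContDiffAt ℝ ∞ B x)
    (hR : ∀ y ∈ Ω, curvature G y = knOp (G y) (B y) (sharp G B y)) {C : E →L[ℝ] E →L[ℝ] E}
    (hC : C = covDerivEnd G (sharp G B) x - (covDerivEnd G (sharp G B) x).flip) (u v w z : E) :
    G x (C u v) z • w + G x (C v w) z • u + G x (C w u) z • v
      = G x w z • C u v + G x u z • C v w + G x v z • C w u := by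
  have hd := hG.differentiableAt hx
  have hQ := hG.differentiableAt_sharp hx hB
  have hB1 := hB.differentiableAt (by simp)
  have hb := curvForm_bianchi ((hG.contDiffAt_christoffel hx).of_le
    (WithTop.coe_le_coe.2 (le_top : (2 : ℕ∞) ≤ ⊤))) u v w z
  have hloc : ∀ v w, (fun y => curvForm (christoffel G) y v w z) =ᶠ[𝓝 x]
      fun y => G y w z • sharp G B y v + B y w z • v - (G y v z • sharp G B y w + B y v z • w) :=
    fun v w => eventually_of_mem (hG.mem_nhds hx) fun y hy => by
      simp only [← curvature_eq_curvForm]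
      rw [hR y hy, knOp_apply]
  have hval : ∀ v w z, curvForm (christoffel G) x v w z
      = G x w z • sharp G B x v + B x w z • v - (G x v z • sharp G B x w + B x v z • w) := by
    intro v w z
    rw [← curvature_eq_curvForm, hR x hx, knOp_apply]
  have hder : ∀ u v w, fderiv ℝ (fun y => curvForm (christoffel G) y v w z) x u
      = (fderiv ℝ G x u w z • sharp G B x v + G x w z • fderiv ℝ (sharp G B) x u v
        + fderiv ℝ B x u w z • v) - (fderiv ℝ G x u v z • sharp G B x w
        + G x v z • fderiv ℝ (sharp G B) x u w + fderiv ℝ B x u v z • w) := by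
    intro u v w
    rw [(hloc v w).fderiv_eq]
    have eG := fun v => (hd.hasFDerivAt.clm_apply (hasFDerivAt_const v x)).clm_apply
      (hasFDerivAt_const z x)
    have eB := fun v => (hB1.hasFDerivAt.clm_apply (hasFDerivAt_const v x)).clm_apply
      (hasFDerivAt_const z x)
    have eQ := fun v => hQ.hasFDerivAt.clm_apply (hasFDerivAt_const v x)
    have e := (((eG w).smul (eQ v)).add ((eB w).smul_const v)).sub
      (((eG v).smul (eQ w)).add ((eB v).smul_const w))
    have e' : HasFDerivAt (fun y => G y w z • sharp G B y v + B y w z • v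
      - (G y v z • sharp G B y w + B y v z • w)) _ x := e
    rw [e'.fderiv]
    simp
    module
  -- Partial derivatives are traded for covariant ones; the Christoffel terms then cancel in the
  -- cyclic sum, and only the antisymmetrization `C` of the covariant derivative survives.
  have hQ' : ∀ u v, fderiv ℝ (sharp G B) x u v = covDerivEnd G (sharp G B) x u v
      - christoffel G x u (sharp G B x v) + sharp G B x (christoffel G x u v) := by
    intro u v
    rw [covDerivEnd_apply]
    abel
  have hB' : ∀ u v, fderiv ℝ B x u v z = G x (covDerivEnd G (sharp G B) x u v) z
      + B x (christoffel G x u v) z + B x v (christoffel G x u z) := by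
    intro u v
    rw [hG.metric_covDerivEnd_sharp hx hB, covDerivBilin_apply]
    abel
  have hCe : ∀ u v, C u v = covDerivEnd G (sharp G B) x u v - covDerivEnd G (sharp G B) x v u := by
    intro u v
    rw [hC]
    rfl
  simp only [hder, hval, hQ', hB', hG.fderiv_eq hx, map_add, map_sub, map_smul] at hb
  rw [hG.christoffel_symm hx v u, hG.christoffel_symm hx w v, hG.christoffel_symm hx w u] at hb
  simp only [hCe, map_sub, sub_apply]
  linear_combination (norm := module) (-1 : ℝ) • hb

variable [FiniteDimensional ℝ E]

/-- By the first Bianchi identity the two endomorphisms being traced differ by the curvature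
operator of `v`, `w`, which is skew and so has trace zero. -/
theorem ricci_symm (v w : E) : ricci G x v w = ricci G x w v := by
  have h : ((curvature G x).flip v).flip w - ((curvature G x).flip w).flip v
      = - curvature G x v w := by
    ext u
    have := hG.curvature_bianchi hx u v w
    have h2 := curvature_antisymm G x w u v
    simp only [sub_apply, neg_apply, ContinuousLinearMap.flip_apply]
    rw [h2] at this
    linear_combination (norm := module) this
  have h0 : traceCLM (curvature G x v w) = 0 :=
    traceCLM_eq_zero_of_skew (hG.symm x hx) (hG.inv x hx) (hG.curvature_skew hx v w)
  have := congrArg traceCLM h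
  rw [map_sub, map_neg, h0, neg_zero, sub_eq_zero] at this
  exact this

omit [FiniteDimensional ℝ E] [CompleteSpace E] in
theorem hess_symm {f : E → ℝ} (hf : ContDiffAt ℝ ∞ f x) (v w : E) :
    hess G f x v w = hess G f x w v := by
  have h : fderiv ℝ (fderiv ℝ f) x v w = fderiv ℝ (fderiv ℝ f) x w v :=
    (hf.isSymmSndFDerivAt (by simpa using WithTop.coe_le_coe.2 (le_top : (2 : ℕ∞) ≤ ⊤))).eq v w
  have e : ∀ v w, hess G f x v w = fderiv ℝ (fderiv ℝ f) x v w
    - fderiv ℝ f x (christoffel G x v w) := fun _ _ => rfl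
  rw [e, e, h, hG.christoffel_symm hx]

theorem schouten_symm {f : E → ℝ} (m μ : ℝ) (hf : ContDiffAt ℝ ∞ f x) (v w : E) :
    schouten G f m μ x v w = schouten G f m μ x w v := by
  simp only [schouten, weightedRicci, smul_apply, sub_apply]
  rw [hG.ricci_symm hx v w, hG.hess_symm hx hf v w, hG.symm x hx v w]

omit [FiniteDimensional ℝ E] [CompleteSpace E] in
/-- The curvature operator, when the Riemann tensor is a Kulkarni-Nomizu product. -/
theorem curvature_eq_knOp
    (h : ∀ u v z w, Rm G x u v z w = kulkarniNomizu (B x) (G x) u v z w) :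
    curvature G x = knOp (G x) (B x) (sharp G B x) := by
  ext u v w
  refine (hG.inv x hx).eq_of_forall_apply fun z => ?_
  have := h u v z w
  rw [Rm, kulkarniNomizu] at this
  rw [this, knOp_apply]
  simp only [map_add, map_sub, map_smul, add_apply, sub_apply, smul_apply, smul_eq_mul,
    hG.metric_sharp hx]
  ring

omit [CompleteSpace E] in
theorem ricci_eq_of_curvature_eq_knOp (hBs : ∀ v w, B x v w = B x w v)
    (hR : curvature G x = knOp (G x) (B x) (sharp G B x)) (v w : E) :
    ricci G x v w = ((Module.finrank ℝ E : ℝ) - 2) * B x v w + trG G B x * G x v w := by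
  have h : ricci G x v w = traceCLM (((curvature G x).flip v).flip w) := rfl
  rw [h, hR, trace_knOp (hG.symm x hx) hBs (hG.metric_sharp hx)]
  rfl

/-- If the weighted Weyl tensor vanishes and `d ≥ 4` or `m > 0`, the weighted Schouten tensor is a
Codazzi tensor. -/
theorem schouten_codazzi {f : E → ℝ} {m μ : ℝ} (hd : 3 ≤ Module.finrank ℝ E)
    (hm : 0 ≤ m) (hdm : Module.finrank ℝ E ≠ 3 ∨ m ≠ 0)
    (hf : ∀ y ∈ Ω, ContDiffAt ℝ ∞ f y) (hf0 : ∀ y ∈ Ω, f y ≠ 0)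
    (hR : ∀ y ∈ Ω, curvature G y
      = knOp (G y) (schouten G f m μ y) (sharp G (schouten G f m μ) y)) (u v w : E) :
    covDerivBilin G (schouten G f m μ) x u v w = covDerivBilin G (schouten G f m μ) x v u w := by
  obtain ⟨P, hP⟩ : ∃ P, P = schouten G f m μ := ⟨_, rfl⟩
  have hd3 : (3 : ℝ) ≤ Module.finrank ℝ E := by exact_mod_cast hd
  have hPs : ∀ y ∈ Ω, ∀ v w, P y v w = P y w v := fun y hy v w => by
    rw [hP]
    exact hG.schouten_symm hy m μ (hf y hy) v w
  have hPc : ∀ y ∈ Ω, ContDiffAt ℝ ∞ P y := fun y hy => by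
    rw [hP]
    exact contDiffAt_schouten m μ (hG.contDiffAt hy) (hG.inv y hy) (hf y hy) (hf0 y hy)
  rw [← hP] at hR ⊢
  obtain ⟨C, hC⟩ : ∃ C, C = covDerivEnd G (sharp G P) x - (covDerivEnd G (sharp G P) x).flip :=
    ⟨_, rfl⟩
  have hCe : ∀ u v, C u v = covDerivEnd G (sharp G P) x u v - covDerivEnd G (sharp G P) x v u := by
    intro u v
    rw [hC]
    rfl
  have hCg : ∀ u v w, G x (C u v) w = covDerivBilin G P x u v w - covDerivBilin G P x v u w := by
    intro u v w
    rw [hCe, map_sub, sub_apply, hG.metric_covDerivEnd_sharp hx (hPc x hx),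
      hG.metric_covDerivEnd_sharp hx (hPc x hx)]
  suffices hC0 : C u v = 0 by
    rw [← sub_eq_zero, ← hCg, hC0]
    simp
  -- The contracted Bianchi identity settles `d ≥ 4` through `h4`; in dimension three only the trace
  -- condition `htr` carries information.
  obtain ⟨htr, h4⟩ := cotton_of_bianchi (hG.symm x hx) (hG.inv x hx) (C := C)
    (fun u v => by rw [hCe, hCe]; abel)
    (hG.knOp_bianchi hx (hPc x hx) hR hC) hd
  by_cases hd' : Module.finrank ℝ E = 3
  swap
  · refine (smul_eq_zero.1 (h4 u v)).resolve_left ?_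
    rw [sub_eq_zero]
    exact_mod_cast hd'
  have hm0 : m ≠ 0 := hdm.resolve_left (not_not.2 hd')
  have hdm2 : (Module.finrank ℝ E : ℝ) + m - 2 ≠ 0 := by linarith
  -- Inserting `Ric = (d - 2) P + (tr P) G` in the definition of `P` gives `m P = -(m / f) ∇²f + (tr
  -- P - J) G`. Multiplication by `f / m`, possible as `m ≠ 0`, produces this `κ`.
  obtain ⟨κ, hκ⟩ : ∃ κ : E → ℝ, κ = fun y => f y * (trG G P y - schoutenScalar G f m μ y) / m :=
    ⟨_, rfl⟩
  have hκd : DifferentiableAt ℝ κ x := by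
    have : ContDiffAt ℝ ∞ κ x := by
      rw [hκ]
      exact ((hf x hx).mul ((contDiffAt_trG (hG.contDiffAt hx) (hG.inv x hx) (hPc x hx)).sub
        (contDiffAt_schoutenScalar m μ (hG.contDiffAt hx) (hG.inv x hx) (hf x hx)
          (hf0 x hx)))).div_const m
    exact this.differentiableAt (by simp)
  have hloc : ∀ y ∈ Ω, ∀ v w, f y * P y v w
      = - (fderiv ℝ (fderiv ℝ f) y v w - fderiv ℝ f y (christoffel G y v w)) + κ y * G y v w := by
    intro y hy v w
    have h1 := hG.ricci_eq_of_curvature_eq_knOp hy (hPs y hy) (hR y hy) v w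
    have h2 : P y v w = (1 / ((Module.finrank ℝ E : ℝ) + m - 2)) * (ricci G y v w
        - m / f y * (fderiv ℝ (fderiv ℝ f) y v w - fderiv ℝ f y (christoffel G y v w))
        - schoutenScalar G f m μ y * G y v w) := by
      rw [hP]
      rfl
    have := hf0 y hy
    rw [h1] at h2
    rw [hκ]
    field_simp at h2 ⊢
    linear_combination h2
  have hfd : DifferentiableAt ℝ f x := (hf x hx).differentiableAt (by simp)
  have hf1 := contDiffAt_fderiv (hf x hx)
  have hf1d := hf1.differentiableAt (by simp)
  have hf2d := (contDiffAt_fderiv hf1).differentiableAt (by simp)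
  have hΓd := hG.differentiableAt_christoffel hx
  have hGd := hG.differentiableAt hx
  have hPd := (hPc x hx).differentiableAt (by simp)
  have hder : ∀ u v w, fderiv ℝ f x u * P x v w + f x * fderiv ℝ P x u v w
      = - (fderiv ℝ (fderiv ℝ (fderiv ℝ f)) x u v w
        - (fderiv ℝ (fderiv ℝ f) x u (christoffel G x v w)
          + fderiv ℝ f x (fderiv ℝ (christoffel G) x u v w)))
        + (fderiv ℝ κ x u * G x v w + κ x * fderiv ℝ G x u v w) := by
    intro u v w
    have c := fun v : E => hasFDerivAt_const (𝕜 := ℝ) v x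
    have e1 := hfd.hasFDerivAt.mul ((hPd.hasFDerivAt.clm_apply (c v)).clm_apply (c w))
    have e2 := (((hf2d.hasFDerivAt.clm_apply (c v)).clm_apply (c w)).sub
      (hf1d.hasFDerivAt.clm_apply ((hΓd.hasFDerivAt.clm_apply (c v)).clm_apply (c w)))).neg.add
      (hκd.hasFDerivAt.mul ((hGd.hasFDerivAt.clm_apply (c v)).clm_apply (c w)))
    have e3 := e1.congr_of_eventuallyEq (eventually_of_mem (hG.mem_nhds hx)
      fun y hy => (hloc y hy v w).symm)
    have := congrArg (fun L => L u) (e3.unique e2)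
    simp at this
    linear_combination this
  have hs3 : ∀ u v, fderiv ℝ (fderiv ℝ (fderiv ℝ f)) x u v
      = fderiv ℝ (fderiv ℝ (fderiv ℝ f)) x v u :=
    (hf1.isSymmSndFDerivAt (by simpa using WithTop.coe_le_coe.2 (le_top : (2 : ℕ∞) ≤ ⊤))).eq
  have hs2 : ∀ u v, fderiv ℝ (fderiv ℝ f) x u v = fderiv ℝ (fderiv ℝ f) x v u :=
    ((hf x hx).isSymmSndFDerivAt (by simpa using WithTop.coe_le_coe.2 (le_top : (2 : ℕ∞) ≤ ⊤))).eq
  -- Antisymmetrizing the derivative of `f P = -∇²f + κ G` produces `df(R(u, v) w)`. For `Rm = P ∧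
  -- G` its terms `df(u) P(v, w)` cancel those coming from the derivative of `f` in `f P`; what is
  -- left is a multiple of `G`, with coefficient `β`.
  obtain ⟨β, hβ⟩ : ∃ β : E →L[ℝ] ℝ, β = fderiv ℝ κ x + fderiv ℝ f x ∘L sharp G P x := ⟨_, rfl⟩
  have hfC : ∀ u v, f x • C u v = β u • v - β v • u := by
    intro u v
    refine (hG.inv x hx).eq_of_forall_apply fun w => ?_
    have hRf := congrArg (fun T => fderiv ℝ f x (T u v w)) (hR x hx)
    simp only [knOp_apply, curvature_apply, map_add, map_sub, map_smul, smul_eq_mul] at hRf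
    simp only [map_sub, map_smul, smul_apply, sub_apply, smul_eq_mul, hCg, hβ,
      covDerivBilin_apply, add_apply, ContinuousLinearMap.comp_apply]
    have l1 := hloc x hx v (christoffel G x u w)
    have l2 := hloc x hx u (christoffel G x v w)
    have d1 := hder u v w
    have d2 := hder v u w
    rw [hG.fderiv_eq hx] at d1 d2
    rw [hs3 v u] at d2
    rw [hG.christoffel_symm hx v u] at d2 ⊢
    rw [hs2 u] at d1
    rw [hs2 v] at d2
    rw [hs2] at l1 l2
    linear_combination d1 - d2 - l1 + l2 + hRf
  -- The right side of `hfC` has trace `(d - 1) β(u)` over `v`, while `C u` is trace free.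
  have hβ0 : ∀ u, β u = 0 := by
    intro u
    have h : f x • C u = β u • ContinuousLinearMap.id ℝ E - β.smulRight u := by
      ext v
      simpa using hfC u v
    have := congrArg traceCLM h
    simp only [map_sub, map_smul, traceCLM_id, traceCLM_smulRight, smul_eq_mul, htr] at this
    have h5 : ((Module.finrank ℝ E : ℝ) - 1) * β u = 0 := by linarith
    exact (mul_eq_zero.1 h5).resolve_left (by linarith)
  have := hfC u v
  rw [hβ0, hβ0, zero_smul, zero_smul, sub_zero] at this
  exact (smul_eq_zero.1 this).resolve_left (hf0 x hx)

/-- In dimension three the (unweighted) Weyl tensor vanishes. -/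
theorem curvature_eq_knOp_of_finrank_eq_three {f : E → ℝ} (μ : ℝ)
    (hd : Module.finrank ℝ E = 3) (hf : ContDiffAt ℝ ∞ f x) :
    curvature G x = knOp (G x) (schouten G f 0 μ x) (sharp G (schouten G f 0 μ) x) := by
  obtain ⟨P, hP⟩ : ∃ P, P = schouten G f 0 μ := ⟨_, rfl⟩
  have hPs : ∀ v w, P x v w = P x w v := fun v w => by
    rw [hP]
    exact hG.schouten_symm hx 0 μ hf v w
  -- For `d = 3`, `m = 0` one has `d + m - 2 = 1` and `J = R / 4`.
  have hPe : P x = ricci G x - (trG G (ricci G) x / 4) • G x := by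
    rw [hP]
    ext v w
    simp only [schouten, weightedRicci, schoutenScalar, weightedScalar, hd]
    simp
    ring
  have hGi : (G x).inverse ∘L G x = ContinuousLinearMap.id ℝ E := by
    ext v
    exact (hG.inv x hx).inverse_apply v
  have hQ : traceCLM (sharp G P x) = trG G (ricci G) x / 4 := by
    have h1 : sharp G P x = sharp G (ricci G) x
        - (trG G (ricci G) x / 4) • ContinuousLinearMap.id ℝ E := by
      rw [sharp, hPe, ContinuousLinearMap.comp_sub, ContinuousLinearMap.comp_smul, hGi]
      rfl
    have h2 : traceCLM (sharp G (ricci G) x) = trG G (ricci G) x := rfl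
    rw [h1, map_sub, map_smul, traceCLM_id, h2, hd]
    simp only [smul_eq_mul]
    push_cast
    ring
  rw [← hP, ← sub_eq_zero]
  -- The Ricci trace of `P ∧ G` is `P + (tr P) G`, and `tr P = R / 4` makes this `Ric`; so the
  -- difference is trace free.
  refine curvatureLike_eq_zero_of_finrank_eq_three hd (hG.symm x hx) (hG.inv x hx) ?_ ?_ ?_
  · intro u v w
    simp only [sub_apply, knOp_apply]
    rw [curvature_antisymm]
    module
  · intro u v w z
    simp only [sub_apply, knOp_apply, map_sub, map_add, map_smul, smul_apply, add_apply,
      hG.metric_sharp hx, smul_eq_mul]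
    rw [hG.curvature_skew hx]
    ring
  · intro v w
    have h : ((curvature G x - knOp (G x) (P x) (sharp G P x)).flip v).flip w
        = ((curvature G x).flip v).flip w - ((knOp (G x) (P x) (sharp G P x)).flip v).flip w :=
      rfl
    have h2 : traceCLM (((curvature G x).flip v).flip w) = ricci G x v w := rfl
    rw [h, map_sub, trace_knOp (hG.symm x hx) hPs (hG.metric_sharp hx), hQ, h2, hPe, hd]
    simp only [sub_apply, smul_apply, smul_eq_mul]
    push_cast
    ring

end IsMetricOn

end Codazzi

/-! ### Invertibility in finite dimension -/

section Invertible

variable {E F : Type*} [NormedAddCommGroup E] [NormedSpace ℝ E] [FiniteDimensional ℝ E]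
  [NormedAddCommGroup F] [NormedSpace ℝ F]

theorem isInvertible_of_injective_endo {T : E →L[ℝ] E} (hT : ∀ v, T v = 0 → v = 0) :
    T.IsInvertible := by
  have h : Function.Injective (T : E →ₗ[ℝ] E) :=
    (injective_iff_map_eq_zero (T : E →ₗ[ℝ] E)).2 hT
  exact ⟨(LinearEquiv.ofInjectiveEndo (T : E →ₗ[ℝ] E) h).toContinuousLinearEquiv, by
    ext v
    rfl⟩

theorem isInvertible_of_nondegenerate {B : E →L[ℝ] E →L[ℝ] ℝ} (hB : ∀ v, B v = 0 → v = 0) :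
    B.IsInvertible := by
  have h : Function.Injective (B : E →ₗ[ℝ] E →L[ℝ] ℝ) :=
    (injective_iff_map_eq_zero (B : E →ₗ[ℝ] E →L[ℝ] ℝ)).2 hB
  have hd : Module.finrank ℝ E = Module.finrank ℝ (E →L[ℝ] ℝ) := by
    rw [← (LinearMap.toContinuousLinearMap : (E →ₗ[ℝ] ℝ) ≃ₗ[ℝ] E →L[ℝ] ℝ).finrank_eq]
    exact Subspace.dual_finrank_eq.symm
  exact ⟨(LinearEquiv.ofInjectiveOfFinrankEq (B : E →ₗ[ℝ] E →L[ℝ] ℝ) h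
    hd).toContinuousLinearEquiv, by
    ext v
    rfl⟩

omit [FiniteDimensional ℝ E] in
theorem isOpen_setOf_isInvertible [CompleteSpace E] :
    IsOpen {T : E →L[ℝ] F | T.IsInvertible} :=
  ContinuousLinearEquiv.isOpen (𝕜 := ℝ) (E := E) (F := F)

end Invertible

/-! ### The metrics `g_ρ` -/

section Family

variable {E : Type*} [NormedAddCommGroup E] [NormedSpace ℝ E] [FiniteDimensional ℝ E]
  [CompleteSpace E]
variable {G : E → E →L[ℝ] E →L[ℝ] ℝ} {Ω : Set E} {x : E} {f : E → ℝ} {m μ : ℝ}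

/-- `B` is a smooth symmetric Codazzi tensor for `G` on `Ω`. -/
structure IsCodazziOn (G B : E → E →L[ℝ] E →L[ℝ] ℝ) (Ω : Set E) : Prop where
  contDiffAt : ∀ x ∈ Ω, ContDiffAt ℝ ∞ B x
  symm : ∀ x ∈ Ω, ∀ v w, B x v w = B x w v
  codazzi : ∀ x ∈ Ω, ∀ u v w, covDerivBilin G B x u v w = covDerivBilin G B x v u w

omit [CompleteSpace E] in
theorem U_apply (ρ : ℝ) (v : E) :
    U G f m μ ρ x v = v + ρ • sharp G (schouten G f m μ) x v := rfl

omit [CompleteSpace E] in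
-- Completing the square, as the endomorphism of the Schouten tensor is self-adjoint.
theorem gRho_eq (hG : IsMetricOn G Ω) (hP : IsCodazziOn G (schouten G f m μ) Ω) (hx : x ∈ Ω)
    (ρ : ℝ) (v w : E) :
    gRho G f m μ ρ x v w = G x (U G f m μ ρ x v) (U G f m μ ρ x w) := by
  have h : gRho G f m μ ρ x v w = G x v w + 2 * ρ * schouten G f m μ x v w
    + ρ ^ 2 * schouten G f m μ x v (sharp G (schouten G f m μ) x w) := rfl
  simp only [h, U_apply, map_add, map_smul, add_apply, smul_apply, smul_eq_mul,
    hG.metric_sharp hx]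
  rw [hG.symm x hx v (sharp G _ x w), hG.metric_sharp hx, hP.symm x hx w v]
  ring

omit [CompleteSpace E] in
-- By `gRho_eq`, the kernel of `U` lies in the kernel of `g_ρ`.
theorem isInvertible_U (hG : IsMetricOn G Ω) (hP : IsCodazziOn G (schouten G f m μ) Ω)
    (hx : x ∈ Ω) {ρ : ℝ} (h : (gRho G f m μ ρ x).IsInvertible) :
    (U G f m μ ρ x).IsInvertible := by
  refine isInvertible_of_injective_endo fun v hv => ?_
  refine h.eq_of_forall_apply (w := 0) fun z => ?_
  rw [gRho_eq hG hP hx, hv]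
  simp

theorem contDiffAt_gRho (hG : IsMetricOn G Ω) (hP : IsCodazziOn G (schouten G f m μ) Ω)
    {X : Type*} [NormedAddCommGroup X] [NormedSpace ℝ X] {r : X → ℝ} {y : X → E} {q : X}
    (hr : ContDiffAt ℝ ∞ r q) (hy : ContDiffAt ℝ ∞ y q) (hq : y q ∈ Ω) :
    ContDiffAt ℝ ∞ (fun p => gRho G f m μ (r p) (y p)) q := by
  have h1 := (hG.contDiffAt hq).comp q hy
  have h2 := (hP.contDiffAt _ hq).comp q hy
  have h3 := (contDiffAt_sharp (hG.contDiffAt hq) (hG.inv _ hq) (hP.contDiffAt _ hq)).comp q hy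
  exact (h1.add ((contDiffAt_const.mul hr).smul h2)).add ((hr.pow 2).smul
    (contDiffAt_bilinearComp h2 contDiffAt_const h3))

theorem isMetricOn_gRho (hG : IsMetricOn G Ω) (hP : IsCodazziOn G (schouten G f m μ) Ω) (ρ : ℝ) :
    IsMetricOn (gRho G f m μ ρ) {x | x ∈ Ω ∧ (gRho G f m μ ρ x).IsInvertible} where
  isOpen := by
    have hc : ContinuousOn (gRho G f m μ ρ) Ω := fun x hx =>
      (contDiffAt_gRho hG hP contDiffAt_const contDiffAt_id
        hx).continuousAt.continuousWithinAt
    exact hc.isOpen_inter_preimage hG.isOpen isOpen_setOf_isInvertible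
  contDiffOn := fun x hx => (contDiffAt_gRho hG hP contDiffAt_const contDiffAt_id
    hx.1).contDiffWithinAt
  symm := fun x hx v w => by
    rw [gRho_eq hG hP hx.1, gRho_eq hG hP hx.1, hG.symm x hx.1]
  inv := fun x hx => hx.2

omit [FiniteDimensional ℝ E] in
theorem covDerivEnd_sharp_symm (hG : IsMetricOn G Ω) {B : E → E →L[ℝ] E →L[ℝ] ℝ}
    (hB : IsCodazziOn G B Ω) (hx : x ∈ Ω) (u v : E) :
    covDerivEnd G (sharp G B) x u v = covDerivEnd G (sharp G B) x v u := by
  refine (hG.inv x hx).eq_of_forall_apply fun w => ?_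
  rw [hG.metric_covDerivEnd_sharp hx (hB.contDiffAt x hx),
    hG.metric_covDerivEnd_sharp hx (hB.contDiffAt x hx), hB.codazzi x hx]

theorem contDiffAt_U (hG : IsMetricOn G Ω) (hP : IsCodazziOn G (schouten G f m μ) Ω)
    (hx : x ∈ Ω) (ρ : ℝ) : ContDiffAt ℝ ∞ (U G f m μ ρ) x :=
  contDiffAt_const.add (ContDiffAt.const_smul ρ
    (contDiffAt_sharp (hG.contDiffAt hx) (hG.inv _ hx) (hP.contDiffAt _ hx)))

theorem fderiv_U (hG : IsMetricOn G Ω) (hP : IsCodazziOn G (schouten G f m μ) Ω)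
    (hx : x ∈ Ω) (ρ : ℝ) (u v : E) : fderiv ℝ (U G f m μ ρ) x u v
      = ρ • fderiv ℝ (sharp G (schouten G f m μ)) x u v := by
  have h : HasFDerivAt (U G f m μ ρ) _ x := (hasFDerivAt_const (ContinuousLinearMap.id ℝ E) x).add
    ((hG.differentiableAt_sharp hx (hP.contDiffAt x hx)).hasFDerivAt.const_smul ρ)
  rw [h.fderiv]
  simp

theorem U_covariant_derivative (hG : IsMetricOn G Ω)
    (hP : IsCodazziOn G (schouten G f m μ) Ω) (hx : x ∈ Ω) (ρ : ℝ) (v w : E) :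
    fderiv ℝ (U G f m μ ρ) x v w + christoffel G x v (U G f m μ ρ x w)
      = U G f m μ ρ x (christoffel G x v w)
        + ρ • covDerivEnd G (sharp G (schouten G f m μ)) x v w := by
  rw [fderiv_U hG hP hx, covDerivEnd_apply, U_apply, U_apply, map_add, map_smul]
  module

/-- `U` is a frame for `g_ρ` with values in the tangent bundle with its connection `∇` of `G`. Its
torsion is `ρ` times the antisymmetrization of `∇P^♯`, zero by the Codazzi equation. -/
theorem U_christoffel_gRho (hG : IsMetricOn G Ω) (hP : IsCodazziOn G (schouten G f m μ) Ω)
    (hx : x ∈ Ω) {ρ : ℝ} (h : (gRho G f m μ ρ x).IsInvertible) (v w : E) :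
    U G f m μ ρ x (christoffel (gRho G f m μ ρ) x v w)
      = fderiv ℝ (U G f m μ ρ) x v w + christoffel G x v (U G f m μ ρ x w) := by
  refine (isMetricOn_gRho hG hP ρ).christoffel_of_frame ⟨hx, h⟩ (hG.differentiableAt hx)
    ((contDiffAt_U hG hP hx ρ).differentiableAt (by simp)) (isInvertible_U hG hP hx h)
    (eventually_of_mem (hG.mem_nhds hx) fun y hy v w => gRho_eq hG hP hy ρ v w)
    (hG.fderiv_eq hx) (fun u v => ?_) v w
  rw [U_covariant_derivative hG hP hx, U_covariant_derivative hG hP hx, hG.christoffel_symm hx,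
    covDerivEnd_sharp_symm hG hP hx]

/-- The Levi-Civita connection of `g_ρ` on one-forms. -/
theorem covDerivForm_gRho (hG : IsMetricOn G Ω) (hP : IsCodazziOn G (schouten G f m μ) Ω)
    (hx : x ∈ Ω) {ρ : ℝ} (h : (gRho G f m μ ρ x).IsInvertible) (η : E → E →L[ℝ] ℝ) (v w : E) :
    covDerivForm (gRho G f m μ ρ) η x v w = covDerivForm G η x v w
      - ρ * η x ((U G f m μ ρ x).inverse ((G x).inverse
          (covDerivBilin G (schouten G f m μ) x w v))) := by
  have hU := isInvertible_U hG hP hx h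
  have h1 : christoffel (gRho G f m μ ρ) x v w = christoffel G x v w
      + ρ • (U G f m μ ρ x).inverse ((G x).inverse
          (covDerivBilin G (schouten G f m μ) x w v)) := by
    have h2 : (G x).inverse (covDerivBilin G (schouten G f m μ) x w v)
        = covDerivEnd G (sharp G (schouten G f m μ)) x v w := by
      -- The Codazzi equation exchanges the differentiation index with the lower index of `P`.
      rw [covDerivEnd_sharp_symm hG hP hx,
        ← (hG.inv x hx).inverse_apply (covDerivEnd G _ x w v)]
      congr 1
      ext z
      rw [hG.metric_covDerivEnd_sharp hx (hP.contDiffAt x hx)]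
    rw [h2, ← hU.inverse_apply (christoffel (gRho G f m μ ρ) x v w),
      U_christoffel_gRho hG hP hx h, U_covariant_derivative hG hP hx, map_add, map_smul,
      hU.inverse_apply]
  rw [covDerivForm, covDerivForm, h1, map_add, map_smul, smul_eq_mul]
  ring

/-- The Riemann tensor of `g_ρ`. -/
theorem Rm_gRho (hG : IsMetricOn G Ω) (hP : IsCodazziOn G (schouten G f m μ) Ω)
    (hx : x ∈ Ω) {ρ : ℝ} (h : (gRho G f m μ ρ x).IsInvertible) (v w z y : E) :
    Rm (gRho G f m μ ρ) x v w z y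
      = Rm G x (U G f m μ ρ x v) (U G f m μ ρ x w) z y := by
  have hρ := isMetricOn_gRho hG hP ρ
  have hΩ : {x | x ∈ Ω ∧ (gRho G f m μ ρ x).IsInvertible} ∈ 𝓝 x := hρ.mem_nhds ⟨hx, h⟩
  have hi := curvForm_intertwine (Ψ := U G f m μ ρ) (A := christoffel (gRho G f m μ ρ))
    (A' := christoffel G) ((contDiffAt_U hG hP hx ρ).of_le
      (WithTop.coe_le_coe.2 (le_top : (2 : ℕ∞) ≤ ⊤)))
    (hρ.differentiableAt_christoffel ⟨hx, h⟩) (hG.differentiableAt_christoffel hx)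
    (eventually_of_mem hΩ fun p hp v w => U_christoffel_gRho hG hP hp.1 hp.2 v w) z y w
  -- Intertwining places `U` on the last two slots of the Riemann tensor; pair symmetry on both
  -- sides moves it to the first two.
  rw [hρ.Rm_pair_symm ⟨hx, h⟩, hG.Rm_pair_symm hx, Rm, Rm, gRho_eq hG hP hx,
    curvature_eq_curvForm, hi, curvature_eq_curvForm]

end Family

/-! ### The ambient metric -/

section Ambient

variable {E : Type*} [NormedAddCommGroup E] [NormedSpace ℝ E]

theorem dt_apply (q : ℝ × E × ℝ) : dt q = q.1 := rfl

theorem dx_apply (q : ℝ × E × ℝ) : dx q = q.2.1 := rfl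

theorem dρ_apply (q : ℝ × E × ℝ) : dρ q = q.2.2 := rfl

theorem hasFDerivAt_time (q : ℝ × E × ℝ) : HasFDerivAt (fun q : ℝ × E × ℝ => q.1) dt q :=
  (dt (E := E)).hasFDerivAt

theorem hasFDerivAt_base (q : ℝ × E × ℝ) : HasFDerivAt (fun q : ℝ × E × ℝ => q.2.1) dx q :=
  (dx (E := E)).hasFDerivAt

theorem hasFDerivAt_parameter (q : ℝ × E × ℝ) :
    HasFDerivAt (fun q : ℝ × E × ℝ => q.2.2) dρ q :=
  (dρ (E := E)).hasFDerivAt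

theorem contDiffAt_time (q : ℝ × E × ℝ) : ContDiffAt ℝ ∞ (fun q : ℝ × E × ℝ => q.1) q :=
  (dt (E := E)).contDiff.contDiffAt

theorem contDiffAt_base (q : ℝ × E × ℝ) : ContDiffAt ℝ ∞ (fun q : ℝ × E × ℝ => q.2.1) q :=
  (dx (E := E)).contDiff.contDiffAt

theorem contDiffAt_parameter (q : ℝ × E × ℝ) :
    ContDiffAt ℝ ∞ (fun q : ℝ × E × ℝ => q.2.2) q :=
  (dρ (E := E)).contDiff.contDiffAt

/-- The inclusion of the first summand of `ℝ × E × ℝ`. -/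
def incFst : ℝ →L[ℝ] ℝ × E × ℝ := ContinuousLinearMap.inl ℝ ℝ (E × ℝ)

/-- The inclusion of the second summand of `ℝ × E × ℝ`. -/
def incMid : E →L[ℝ] ℝ × E × ℝ :=
  ContinuousLinearMap.inr ℝ ℝ (E × ℝ) ∘L ContinuousLinearMap.inl ℝ E ℝ

/-- The inclusion of the third summand of `ℝ × E × ℝ`. -/
def incLast : ℝ →L[ℝ] ℝ × E × ℝ :=
  ContinuousLinearMap.inr ℝ ℝ (E × ℝ) ∘L ContinuousLinearMap.inr ℝ E ℝ

theorem incFst_apply (a : ℝ) : incFst (E := E) a = (a, 0, 0) := rfl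

theorem incMid_apply (v : E) : incMid v = (0, v, 0) := rfl

theorem incLast_apply (a : ℝ) : incLast (E := E) a = (0, 0, a) := rfl

/-- The map `L ↦ i ∘ L ∘ dx`. -/
def viaMid {K : Type*} [NormedAddCommGroup K] [NormedSpace ℝ K] (i : K →L[ℝ] ℝ × E × ℝ) :
    (E →L[ℝ] K) →L[ℝ] (ℝ × E × ℝ) →L[ℝ] (ℝ × E × ℝ) :=
  ContinuousLinearMap.compL ℝ (ℝ × E × ℝ) K (ℝ × E × ℝ) i
    ∘L (ContinuousLinearMap.compL ℝ (ℝ × E × ℝ) E K).flip dx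

theorem viaMid_apply {K : Type*} [NormedAddCommGroup K] [NormedSpace ℝ K]
    (i : K →L[ℝ] ℝ × E × ℝ) (L : E →L[ℝ] K) (z : ℝ × E × ℝ) : viaMid i L z = i (L z.2.1) := rfl

/-- The map `v ↦ (z ↦ φ(z) v)` with values in the second summand. -/
def scalarMid (φ : (ℝ × E × ℝ) →L[ℝ] ℝ) : E →L[ℝ] (ℝ × E × ℝ) →L[ℝ] (ℝ × E × ℝ) :=
  ContinuousLinearMap.compL ℝ (ℝ × E × ℝ) E (ℝ × E × ℝ) incMid
    ∘L ContinuousLinearMap.smulRightL ℝ (ℝ × E × ℝ) E φ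

theorem scalarMid_apply (φ : (ℝ × E × ℝ) →L[ℝ] ℝ) (v : E) (z : ℝ × E × ℝ) :
    scalarMid φ v z = incMid (φ z • v) := rfl

/-- The tractor connection
`(σ, ξ, τ) ↦ (- B(v, ξ), Γ(v, ξ) + σ v + τ B^♯ v, - G(v, ξ))` in the direction `v`. -/
def tractorConn (G B : E → E →L[ℝ] E →L[ℝ] ℝ) (x : E) :
    E →L[ℝ] (ℝ × E × ℝ) →L[ℝ] (ℝ × E × ℝ) :=
  viaMid incMid ∘L christoffel G x + scalarMid dt + scalarMid dρ ∘L sharp G B x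
    - viaMid incFst ∘L B x - viaMid incLast ∘L G x

theorem tractorConn_apply (G B : E → E →L[ℝ] E →L[ℝ] ℝ) (x v : E) (z : ℝ × E × ℝ) :
    tractorConn G B x v z = (- B x v z.2.1,
      christoffel G x v z.2.1 + z.1 • v + z.2.2 • sharp G B x v, - G x v z.2.1) := by
  simp [tractorConn, viaMid_apply, scalarMid_apply, incFst_apply, incMid_apply, incLast_apply,
    dt_apply, dρ_apply]

/-- The tractor metric `2 σ τ + G(ξ, ξ)`. -/
def tractorMetric (G : E → E →L[ℝ] E →L[ℝ] ℝ) (x : E) :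
    (ℝ × E × ℝ) →L[ℝ] (ℝ × E × ℝ) →L[ℝ] ℝ :=
  (dt (E := E)).smulRight (dρ (E := E)) + (dρ (E := E)).smulRight (dt (E := E)) + (G x).bilinearComp dx dx

theorem tractorMetric_apply (G : E → E →L[ℝ] E →L[ℝ] ℝ) (x : E) (a b : ℝ × E × ℝ) :
    tractorMetric G x a b = a.1 * b.2.2 + a.2.2 * b.1 + G x a.2.1 b.2.1 := by
  simp [tractorMetric, dt_apply, dρ_apply, dx_apply]

/-! ### Flatness of the tractor connection. -/

variable {G B : E → E →L[ℝ] E →L[ℝ] ℝ} {Ω : Set E} {x : E}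

theorem contDiffAt_tractorConn [CompleteSpace E] (hG : IsMetricOn G Ω)
    (hB : ContDiffAt ℝ ∞ B x) (hx : x ∈ Ω) : ContDiffAt ℝ ∞ (tractorConn G B) x := by
  have c := fun {K : Type _} [NormedAddCommGroup K] [NormedSpace ℝ K] (T : K) =>
    contDiffAt_const (𝕜 := ℝ) (n := ∞) (x := x) (c := T)
  exact (((((c (viaMid incMid)).clm_comp (hG.contDiffAt_christoffel hx)).add
    (c (scalarMid dt))).add ((c (scalarMid dρ)).clm_comp
      (contDiffAt_sharp (hG.contDiffAt hx) (hG.inv x hx) hB))).sub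
    ((c (viaMid incFst)).clm_comp hB)).sub ((c (viaMid incLast)).clm_comp (hG.contDiffAt hx))

variable [FiniteDimensional ℝ E] [CompleteSpace E]

omit [FiniteDimensional ℝ E] in
/-- The tractor connection is flat. -/
theorem curvForm_tractorConn (hG : IsMetricOn G Ω) (hB : IsCodazziOn G B Ω) (hx : x ∈ Ω)
    (hR : curvature G x = knOp (G x) (B x) (sharp G B x)) (u v : E) (z : ℝ × E × ℝ) :
    curvForm (tractorConn G B) x u v z = 0 := by
  have hd := (contDiffAt_tractorConn hG (hB.contDiffAt x hx) hx).differentiableAt (by simp)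
  have hder : ∀ u v, fderiv ℝ (tractorConn G B) x u v z = (- fderiv ℝ B x u v z.2.1,
      fderiv ℝ (christoffel G) x u v z.2.1 + z.2.2 • fderiv ℝ (sharp G B) x u v,
      - fderiv ℝ G x u v z.2.1) := by
    intro u v
    have c := fun {K : Type _} [NormedAddCommGroup K] [NormedSpace ℝ K] (T : K) =>
      hasFDerivAt_const (𝕜 := ℝ) T x
    have e1 := (hd.hasFDerivAt.clm_apply (c v)).clm_apply (c z)
    have eB := (((hB.contDiffAt x hx).differentiableAt (by simp)).hasFDerivAt.clm_apply
      (c v)).clm_apply (c z.2.1)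
    have eG := ((hG.differentiableAt hx).hasFDerivAt.clm_apply (c v)).clm_apply (c z.2.1)
    have eΓ := ((hG.differentiableAt_christoffel hx).hasFDerivAt.clm_apply
      (c v)).clm_apply (c z.2.1)
    have eQ := (hG.differentiableAt_sharp hx (hB.contDiffAt x hx)).hasFDerivAt.clm_apply (c v)
    have e2 := eB.neg.prodMk (((eΓ.add (c (z.1 • v))).add (eQ.const_smul z.2.2)).prodMk eG.neg)
    have e3 := e2.congr_of_eventuallyEq (f₁ := fun y => tractorConn G B y v z)
      (Eventually.of_forall fun y => tractorConn_apply G B y v z)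
    have := congrArg (fun L => L u) (e1.unique e3)
    simpa using this
  have hcod := hB.codazzi x hx u v z.2.1
  have hcov := covDerivEnd_sharp_symm hG hB hx u v
  have hRz := congrArg (fun T => T u v z.2.1) (hR)
  have hQ : ∀ a b, G x a (sharp G B x b) = B x a b := fun a b => by
    rw [hG.symm x hx, hG.metric_sharp hx, hB.symm x hx]
  have hBQ : B x u (sharp G B x v) = B x v (sharp G B x u) := by
    rw [hB.symm x hx v, ← hG.metric_sharp hx, hQ, ← hQ, hG.metric_sharp hx,
      hB.symm x hx u, ← hQ, hG.metric_sharp hx, hB.symm x hx]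
  simp only [covDerivBilin_apply] at hcod
  simp only [covDerivEnd_apply] at hcov
  simp only [curvature_apply, knOp_apply] at hRz
  rw [curvForm, hder, hder, tractorConn_apply, tractorConn_apply, tractorConn_apply,
    tractorConn_apply]
  rw [hG.christoffel_symm hx v u] at hcod hcov
  -- The first slot is the Cotton tensor of `B`. The middle one is `Rm - B ∧ G` together with `τ`
  -- times the Cotton tensor. The last one vanishes by symmetry and `∇G = 0`.
  refine Prod.ext ?_ (Prod.ext ?_ ?_)
  · simp only [Prod.fst_add, Prod.fst_sub, map_add, map_smul, smul_eq_mul, Prod.fst_zero,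
      hBQ, hB.symm x hx v u]
    linear_combination - hcod
  · simp only [Prod.fst_add, Prod.fst_sub, Prod.snd_add, Prod.snd_sub, map_add, map_smul,
      Prod.fst_zero, Prod.snd_zero, hG.christoffel_symm hx v u]
    linear_combination (norm := module) hRz + z.2.2 • hcov
  · simp only [Prod.snd_add, Prod.snd_sub, map_add, map_smul, smul_eq_mul,
      Prod.snd_zero, hG.symm x hx v u, hQ, hB.symm x hx v u, hG.fderiv_eq hx,
      hG.christoffel_symm hx v u]
    ring

/-! ### The ambient coframe and flatness of the ambient metric. -/

variable {f : E → ℝ} {m μ : ℝ}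

/-- The coframe `(dt, t U dx, ρ dt + t dρ)` of the ambient metric. -/
def ambientFrame (G : E → E →L[ℝ] E →L[ℝ] ℝ) (f : E → ℝ) (m μ : ℝ) (q : ℝ × E × ℝ) :
    (ℝ × E × ℝ) →L[ℝ] (ℝ × E × ℝ) :=
  incFst ∘L dt + q.1 • (incMid ∘L U G f m μ q.2.2 q.2.1 ∘L dx)
    + incLast ∘L (q.2.2 • dt + q.1 • dρ)

omit [CompleteSpace E] in
theorem ambientFrame_apply (q z : ℝ × E × ℝ) : ambientFrame G f m μ q z
    = (z.1, q.1 • (z.2.1 + q.2.2 • sharp G (schouten G f m μ) q.2.1 z.2.1),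
      q.2.2 * z.1 + q.1 * z.2.2) := by
  simp [ambientFrame, incFst_apply, incMid_apply, incLast_apply, dt_apply, dρ_apply, dx_apply,
    U_apply]

theorem contDiffAt_ambientFrame (hG : IsMetricOn G Ω) (hP : IsCodazziOn G (schouten G f m μ) Ω)
    {q : ℝ × E × ℝ} (hq : q.2.1 ∈ Ω) : ContDiffAt ℝ ∞ (ambientFrame G f m μ) q := by
  have ht := contDiffAt_time q
  have hρ := contDiffAt_parameter q
  have hx := contDiffAt_base q
  have hQ := (contDiffAt_sharp (hG.contDiffAt hq) (hG.inv _ hq) (hP.contDiffAt _ hq)).comp q hx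
  have hU : ContDiffAt ℝ ∞ (fun q : ℝ × E × ℝ => U G f m μ q.2.2 q.2.1) q :=
    contDiffAt_const.add (hρ.smul hQ)
  exact (contDiffAt_const.add (ht.smul (contDiffAt_const.clm_comp
    (hU.clm_comp contDiffAt_const)))).add (contDiffAt_const.clm_comp
      ((hρ.smul contDiffAt_const).add (ht.smul contDiffAt_const)))

theorem fderiv_ambientFrame (hG : IsMetricOn G Ω) (hP : IsCodazziOn G (schouten G f m μ) Ω)
    {q : ℝ × E × ℝ} (hq : q.2.1 ∈ Ω) (X Y : ℝ × E × ℝ) :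
    fderiv ℝ (ambientFrame G f m μ) q X Y
      = (0, X.1 • (Y.2.1 + q.2.2 • sharp G (schouten G f m μ) q.2.1 Y.2.1)
          + q.1 • (X.2.2 • sharp G (schouten G f m μ) q.2.1 Y.2.1
            + q.2.2 • fderiv ℝ (sharp G (schouten G f m μ)) q.2.1 X.2.1 Y.2.1),
        X.2.2 * Y.1 + X.1 * Y.2.2) := by
  have hd := (contDiffAt_ambientFrame hG hP hq).differentiableAt (by simp)
  have ht := hasFDerivAt_time q
  have hρ := hasFDerivAt_parameter q
  have hx := hasFDerivAt_base q
  have hQ := ((hG.differentiableAt_sharp hq (hP.contDiffAt _ hq)).hasFDerivAt.comp q hx).clm_apply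
    (hasFDerivAt_const Y.2.1 q)
  have e := (hasFDerivAt_const Y.1 q).prodMk
    ((ht.smul ((hasFDerivAt_const Y.2.1 q).add (hρ.smul hQ))).prodMk
      ((hρ.mul_const Y.1).add (ht.mul_const Y.2.2)))
  have e' := e.congr_of_eventuallyEq (f₁ := fun q => ambientFrame G f m μ q Y)
    (Eventually.of_forall fun q => ambientFrame_apply q Y)
  rw [← fderiv_clm_apply_const hd, e'.fderiv]
  simp [dt_apply, dx_apply, dρ_apply]
  constructor
  · module
  · ring

omit [CompleteSpace E] in
-- The terms without `g_ρ` factor as `2 dt (ρ dt + t dρ)`, the hyperbolic part `2 σ τ`; the rest is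
-- `gRho_eq` scaled by `t²`.
theorem ambientMetric_eq (hG : IsMetricOn G Ω) (hP : IsCodazziOn G (schouten G f m μ) Ω)
    {q : ℝ × E × ℝ} (hq : q.2.1 ∈ Ω) (X Y : ℝ × E × ℝ) :
    ambientMetric G f m μ q X Y
      = tractorMetric G q.2.1 (ambientFrame G f m μ q X) (ambientFrame G f m μ q Y) := by
  obtain ⟨t, x, ρ⟩ := q
  obtain ⟨a, v, b⟩ := X
  obtain ⟨a', v', b'⟩ := Y
  rw [ambientMetric_apply, tractorMetric_apply, ambientFrame_apply, ambientFrame_apply,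
    gRho_eq hG hP hq, U_apply, U_apply]
  simp only [map_smul, smul_apply, smul_eq_mul]
  ring

/-- The part over `Ω` of the domain of the ambient metric. -/
def ambientDomain (G : E → E →L[ℝ] E →L[ℝ] ℝ) (f : E → ℝ) (m μ : ℝ) (Ω : Set E) :
    Set (ℝ × E × ℝ) :=
  {q | 0 < q.1 ∧ q.2.1 ∈ Ω ∧ (gRho G f m μ q.2.2 q.2.1).IsInvertible}

omit [CompleteSpace E] in
-- The coframe is block triangular with diagonal blocks `1`, `t U`, `t`, where `t > 0`.
theorem isInvertible_ambientFrame (hG : IsMetricOn G Ω)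
    (hP : IsCodazziOn G (schouten G f m μ) Ω) {q : ℝ × E × ℝ}
    (hq : q ∈ ambientDomain G f m μ Ω) : (ambientFrame G f m μ q).IsInvertible := by
  refine isInvertible_of_injective_endo fun z hz => ?_
  rw [ambientFrame_apply] at hz
  have h1 : z.1 = 0 := congrArg Prod.fst hz
  have h2 : q.1 • U G f m μ q.2.2 q.2.1 z.2.1 = 0 := congrArg (fun a => a.2.1) hz
  have h3 : q.2.2 * z.1 + q.1 * z.2.2 = 0 := congrArg (fun a => a.2.2) hz
  have ht : q.1 ≠ 0 := hq.1.ne'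
  have h4 := (smul_eq_zero.1 h2).resolve_left ht
  have h5 : z.2.1 = 0 := by
    rw [← (isInvertible_U hG hP hq.2.1 hq.2.2).inverse_apply z.2.1, h4, map_zero]
  rw [h1, mul_zero, zero_add] at h3
  exact Prod.ext h1 (Prod.ext h5 ((mul_eq_zero.1 h3).resolve_left ht))

theorem isOpen_ambientDomain (hG : IsMetricOn G Ω)
    (hP : IsCodazziOn G (schouten G f m μ) Ω) : IsOpen (ambientDomain G f m μ Ω) := by
  have hO : IsOpen {q : ℝ × E × ℝ | 0 < q.1 ∧ q.2.1 ∈ Ω} :=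
    (isOpen_Ioi.preimage continuous_fst).inter
      (hG.isOpen.preimage (continuous_fst.comp continuous_snd))
  have hc : ContinuousOn (fun q : ℝ × E × ℝ => gRho G f m μ q.2.2 q.2.1)
      {q : ℝ × E × ℝ | 0 < q.1 ∧ q.2.1 ∈ Ω} := fun q hq =>
    (contDiffAt_gRho hG hP (contDiffAt_parameter q) (contDiffAt_base q)
      hq.2).continuousAt.continuousWithinAt
  have h := hc.isOpen_inter_preimage hO isOpen_setOf_isInvertible
  have he : ambientDomain G f m μ Ω = {q : ℝ × E × ℝ | 0 < q.1 ∧ q.2.1 ∈ Ω} ∩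
      (fun q : ℝ × E × ℝ => gRho G f m μ q.2.2 q.2.1) ⁻¹' {T | T.IsInvertible} :=
    Set.ext fun q => and_assoc.symm
  rw [he]
  exact h

theorem contDiffAt_ambientMetric (hG : IsMetricOn G Ω)
    (hP : IsCodazziOn G (schouten G f m μ) Ω) {q : ℝ × E × ℝ} (hq : q.2.1 ∈ Ω) :
    ContDiffAt ℝ ∞ (ambientMetric G f m μ) q := by
  have ht := contDiffAt_time q
  have hρ := contDiffAt_parameter q
  have h1 := contDiffAt_bilinearComp (contDiffAt_gRho hG hP hρ (contDiffAt_base q) hq)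
    (contDiffAt_const (c := dx (E := E))) (contDiffAt_const (c := dx (E := E)))
  have h2 : ContDiffAt ℝ ∞ (fun q : ℝ × E × ℝ => 2 * q.2.2) q := contDiffAt_const.mul hρ
  have h3 := h2.smul (contDiffAt_const (c := (dt (E := E)).smulRight (dt (E := E))))
  have h4 := ht.smul (contDiffAt_const
    (c := (dt (E := E)).smulRight (dρ (E := E)) + (dρ (E := E)).smulRight (dt (E := E))))
  exact (h3.add h4).add ((ht.pow 2).smul h1)

omit [CompleteSpace E] in
theorem isInvertible_ambientMetric (hG : IsMetricOn G Ω)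
    (hP : IsCodazziOn G (schouten G f m μ) Ω) {q : ℝ × E × ℝ}
    (hq : q ∈ ambientDomain G f m μ Ω) : (ambientMetric G f m μ q).IsInvertible := by
  have hΦ := isInvertible_ambientFrame hG hP hq
  refine isInvertible_of_nondegenerate fun X hX => ?_
  obtain ⟨a, ha⟩ : ∃ a, a = ambientFrame G f m μ q X := ⟨_, rfl⟩
  have h : ∀ b, tractorMetric G q.2.1 a b = 0 := fun b => by
    rw [← hΦ.apply_inverse b, ha, ← ambientMetric_eq hG hP hq.2.1, hX]
    rfl
  have h1 : a.2.2 = 0 := by simpa [tractorMetric_apply] using h (1, 0, 0)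
  have h2 : a.1 = 0 := by simpa [tractorMetric_apply] using h (0, 0, 1)
  have h3 : a.2.1 = 0 := (hG.inv _ hq.2.1).eq_of_forall_apply (w := 0) fun z => by
    simpa [tractorMetric_apply] using h (0, z, 0)
  have h4 : a = 0 := Prod.ext h2 (Prod.ext h3 h1)
  rw [← hΦ.inverse_apply X, ← ha, h4, map_zero]

theorem isMetricOn_ambientMetric (hG : IsMetricOn G Ω)
    (hP : IsCodazziOn G (schouten G f m μ) Ω) :
    IsMetricOn (ambientMetric G f m μ) (ambientDomain G f m μ Ω) where
  isOpen := isOpen_ambientDomain hG hP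
  contDiffOn := fun _ hq => (contDiffAt_ambientMetric hG hP hq.2.1).contDiffWithinAt
  symm := fun q hq X Y => by
    rw [ambientMetric_eq hG hP hq.2.1, ambientMetric_eq hG hP hq.2.1, tractorMetric_apply,
      tractorMetric_apply, hG.symm _ hq.2.1]
    ring
  inv := fun _ hq => isInvertible_ambientMetric hG hP hq

omit [FiniteDimensional ℝ E] [CompleteSpace E] in
theorem contDiffAt_tractorMetric (hG : IsMetricOn G Ω) {q : ℝ × E × ℝ} (hq : q.2.1 ∈ Ω) :
    ContDiffAt ℝ ∞ (fun q : ℝ × E × ℝ => tractorMetric G q.2.1) q := by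
  have h1 : ContDiffAt ℝ ∞ (fun q : ℝ × E × ℝ => G q.2.1) q :=
    (hG.contDiffAt hq).comp q (contDiffAt_base q)
  have h2 := contDiffAt_bilinearComp h1 (contDiffAt_const (c := dx (E := E)))
    (contDiffAt_const (c := dx (E := E)))
  have h3 := contDiffAt_const (𝕜 := ℝ) (n := ∞) (x := q)
    (c := (dt (E := E)).smulRight (dρ (E := E)) + (dρ (E := E)).smulRight (dt (E := E)))
  exact h3.add h2

omit [FiniteDimensional ℝ E] [CompleteSpace E] in
theorem fderiv_tractorMetric (hG : IsMetricOn G Ω) {q : ℝ × E × ℝ} (hq : q.2.1 ∈ Ω)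
    (X a b : ℝ × E × ℝ) : fderiv ℝ (fun q : ℝ × E × ℝ => tractorMetric G q.2.1) q X a b
      = fderiv ℝ G q.2.1 X.2.1 a.2.1 b.2.1 := by
  have hd := (contDiffAt_tractorMetric hG hq).differentiableAt (by simp)
  have e1 := (hd.hasFDerivAt.clm_apply (hasFDerivAt_const a q)).clm_apply (hasFDerivAt_const b q)
  have e0 : HasFDerivAt (fun y => G y a.2.1 b.2.1) _ q.2.1 :=
    ((hG.differentiableAt hq).hasFDerivAt.clm_apply (hasFDerivAt_const a.2.1 q.2.1)).clm_apply
      (hasFDerivAt_const b.2.1 q.2.1)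
  have e2 := HasFDerivAt.comp (g := fun y => G y a.2.1 b.2.1) q e0 (hasFDerivAt_base q)
  have e3 := (hasFDerivAt_const (a.1 * b.2.2 + a.2.2 * b.1) q).add e2
  have e4 := e3.congr_of_eventuallyEq (f₁ := fun q : ℝ × E × ℝ => tractorMetric G q.2.1 a b)
    (Eventually.of_forall fun p => tractorMetric_apply G p.2.1 a b)
  have := congrArg (fun L => L X) (e1.unique e4)
  simpa [dx_apply] using this

omit [FiniteDimensional ℝ E] [CompleteSpace E] in
-- The tractor connection preserves the tractor metric: only the `G` block depends on the point, and
-- the couplings of the outer slots to the middle one cancel in pairs.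
theorem tractorConn_metric (hG : IsMetricOn G Ω) (hx : x ∈ Ω)
    (v : E) (a b : ℝ × E × ℝ) : fderiv ℝ G x v a.2.1 b.2.1
      = tractorMetric G x (tractorConn G B x v a) b
        + tractorMetric G x a (tractorConn G B x v b) := by
  have hQ : ∀ v w, G x v (sharp G B x w) = B x w v := fun v w => by
    rw [hG.symm x hx, hG.metric_sharp hx]
  rw [hG.fderiv_eq hx]
  simp only [tractorConn_apply, tractorMetric_apply, map_add, map_smul, add_apply, smul_apply,
    smul_eq_mul, hG.metric_sharp hx, hQ]
  rw [hG.symm x hx a.2.1 v]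
  ring

/-- The outer slots are symmetric because `P` and `P^2` are symmetric forms; the middle slot is `t
ρ` times the Codazzi equation. -/
theorem ambientFrame_torsion_free (hG : IsMetricOn G Ω)
    (hP : IsCodazziOn G (schouten G f m μ) Ω) {q : ℝ × E × ℝ} (hq : q.2.1 ∈ Ω)
    (X Y : ℝ × E × ℝ) :
    fderiv ℝ (ambientFrame G f m μ) q X Y
        + tractorConn G (schouten G f m μ) q.2.1 X.2.1 (ambientFrame G f m μ q Y)
      = fderiv ℝ (ambientFrame G f m μ) q Y X
        + tractorConn G (schouten G f m μ) q.2.1 Y.2.1 (ambientFrame G f m μ q X) := by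
  rw [fderiv_ambientFrame hG hP hq, fderiv_ambientFrame hG hP hq]
  have hcov := covDerivEnd_sharp_symm hG hP hq X.2.1 Y.2.1
  have hPs := hP.symm _ hq
  have hQ : ∀ a b, G q.2.1 a (sharp G (schouten G f m μ) q.2.1 b)
      = schouten G f m μ q.2.1 b a := fun a b => by
    rw [hG.symm _ hq, hG.metric_sharp hq]
  have hPQ : schouten G f m μ q.2.1 X.2.1 (sharp G (schouten G f m μ) q.2.1 Y.2.1)
      = schouten G f m μ q.2.1 Y.2.1 (sharp G (schouten G f m μ) q.2.1 X.2.1) := by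
    rw [← hQ, hG.symm _ hq, hQ]
  simp only [covDerivEnd_apply] at hcov
  rw [hG.christoffel_symm hq Y.2.1 X.2.1] at hcov
  simp only [tractorConn_apply, ambientFrame_apply]
  generalize schouten G f m μ = P at *
  refine Prod.ext ?_ (Prod.ext ?_ ?_)
  · simp only [Prod.fst_add, map_add, map_smul, smul_eq_mul, hPQ, hPs Y.2.1 X.2.1]
  · simp only [Prod.fst_add, Prod.snd_add, map_add, map_smul,
      hG.christoffel_symm hq Y.2.1 X.2.1]
    linear_combination (norm := module) (q.1 * q.2.2) • hcov
  · simp only [Prod.snd_add, map_add, map_smul, smul_eq_mul, hQ,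
      hG.symm _ hq Y.2.1 X.2.1, hPs Y.2.1 X.2.1]
    ring

theorem ambientFrame_christoffel (hG : IsMetricOn G Ω)
    (hP : IsCodazziOn G (schouten G f m μ) Ω) {q : ℝ × E × ℝ}
    (hq : q ∈ ambientDomain G f m μ Ω) (X Y : ℝ × E × ℝ) :
    ambientFrame G f m μ q (christoffel (ambientMetric G f m μ) q X Y)
      = fderiv ℝ (ambientFrame G f m μ) q X Y
        + (tractorConn G (schouten G f m μ) q.2.1 ∘L dx) X (ambientFrame G f m μ q Y) := by
  have hloc : ∀ᶠ p in 𝓝 q, p ∈ ambientDomain G f m μ Ω :=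
    (isMetricOn_ambientMetric hG hP).mem_nhds hq
  refine (isMetricOn_ambientMetric hG hP).christoffel_of_frame hq
    (H := fun q => tractorMetric G q.2.1)
    (A := fun q => tractorConn G (schouten G f m μ) q.2.1 ∘L dx)
    ((contDiffAt_tractorMetric hG hq.2.1).differentiableAt (by simp))
    ((contDiffAt_ambientFrame hG hP hq.2.1).differentiableAt (by simp))
    (isInvertible_ambientFrame hG hP hq)
    (hloc.mono fun p hp X Y => ambientMetric_eq hG hP hp.2.1 X Y)
    (fun X a b => ?_) (fun X Y => ?_) X Y
  · rw [fderiv_tractorMetric hG hq.2.1]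
    exact tractorConn_metric hG hq.2.1 X.2.1 a b
  · exact ambientFrame_torsion_free hG hP hq.2.1 X Y

/-- The ambient metric is flat. -/
theorem isFlatMetricOn_ambientMetric (hG : IsMetricOn G Ω)
    (hP : IsCodazziOn G (schouten G f m μ) Ω)
    (hR : ∀ x ∈ Ω, curvature G x
      = knOp (G x) (schouten G f m μ x) (sharp G (schouten G f m μ) x)) :
    IsFlatMetricOn (ambientMetric G f m μ) (ambientDomain G f m μ Ω) := by
  have hM := isMetricOn_ambientMetric hG hP
  refine ⟨hM.isOpen, hM.contDiffOn, fun q hq => ⟨hM.symm q hq, hM.inv q hq, fun X Y Z W => ?_⟩⟩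
  have hx := hasFDerivAt_base q
  have hT := contDiffAt_tractorConn hG (hP.contDiffAt _ hq.2.1) hq.2.1
  have hA : HasFDerivAt (fun q : ℝ × E × ℝ => tractorConn G (schouten G f m μ) q.2.1 ∘L dx) _ q :=
    ((hT.differentiableAt (by simp)).hasFDerivAt.comp q hx).clm_comp (hasFDerivAt_const dx q)
  have hloc : ∀ᶠ p in 𝓝 q, p ∈ ambientDomain G f m μ Ω := hM.mem_nhds hq
  have hi := curvForm_intertwine (Ψ := ambientFrame G f m μ)
    (A := christoffel (ambientMetric G f m μ))
    (A' := fun q => tractorConn G (schouten G f m μ) q.2.1 ∘L dx)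
    ((contDiffAt_ambientFrame hG hP hq.2.1).of_le
      (WithTop.coe_le_coe.2 (le_top : (2 : ℕ∞) ≤ ⊤)))
    (hM.differentiableAt_christoffel hq) hA.differentiableAt
    (hloc.mono fun p hp v w => ambientFrame_christoffel hG hP hp v w) X Y W
  -- The curvature of a connection pulled back along the linear projection `dx` is the pull-back of
  -- its curvature.
  have h0 : curvForm (fun q : ℝ × E × ℝ => tractorConn G (schouten G f m μ) q.2.1 ∘L dx) q X Y
      (ambientFrame G f m μ q W) = 0 := by
    rw [← curvForm_tractorConn hG hP hq.2.1 (hR _ hq.2.1) X.2.1 Y.2.1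
      (ambientFrame G f m μ q W), curvForm, curvForm, hA.fderiv]
    simp [dx_apply]
  rw [h0] at hi
  rw [Rm, curvature_eq_curvForm,
    ← (isInvertible_ambientFrame hG hP hq).inverse_apply (curvForm _ q X Y W), hi]
  simp

end Ambient

/-! ### Coordinate expressions on a manifold -/

section Manifold

open Bundle

variable {d : ℕ} {M : Type*} [TopologicalSpace M] [ChartedSpace (EuclideanSpace ℝ (Fin d)) M]
  [IsManifold (𝓡 d) ∞ M]

theorem _root_.ContMDiffOn.contMDiffOn_mfderiv_const {d : ℕ} {M : Type*} [TopologicalSpace M]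
    [ChartedSpace (EuclideanSpace ℝ (Fin d)) M] [IsManifold (𝓡 d) ∞ M]
    {φ : EuclideanSpace ℝ (Fin d) → M} {s : Set (EuclideanSpace ℝ (Fin d))} (hs : IsOpen s)
    (hφ : ContMDiffOn (𝓡 d) (𝓡 d) ∞ φ s) (v : EuclideanSpace ℝ (Fin d)) :
    ContMDiffOn (𝓡 d) (𝓡 d).tangent ∞ (fun y => (TotalSpace.mk' (EuclideanSpace ℝ (Fin d)) (φ y)
      (mfderiv (𝓡 d) (𝓡 d) φ y v) : TangentBundle (𝓡 d) M)) s := by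
  have : IsManifold (𝓡 d) 1 M := IsManifold.of_le (n := ∞) (by simp)
  have h1 := hφ.contMDiffOn_tangentMapWithin (m := ∞) (by simp) hs.uniqueMDiffOn
  have h2 : ContMDiffOn (𝓡 d) (𝓡 d).tangent ∞ (fun y : EuclideanSpace ℝ (Fin d) =>
      (TotalSpace.mk' (EuclideanSpace ℝ (Fin d)) y v :
        TangentBundle (𝓡 d) (EuclideanSpace ℝ (Fin d)))) s :=
    contMDiffOn_vectorSpace_iff_contDiffOn.2 contDiffOn_const
  refine (h1.comp h2 fun y hy => hy).congr fun y hy => ?_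
  simp only [Function.comp, tangentMapWithin]
  rw [mfderivWithin_of_isOpen hs hy]

/-- Smoothness is tested on fixed vectors `v`, `w`, where the coordinate expression is the smooth
metric section evaluated on two smooth vector fields along `e.symm`. -/
theorem SmoothMetricMeasure.contDiffOn_metricIn (S : SmoothMetricMeasure d M)
    {e : OpenPartialHomeomorph M (EuclideanSpace ℝ (Fin d))}
    (he : e ∈ IsManifold.maximalAtlas (𝓡 d) ∞ M) : ContDiffOn ℝ ∞ (S.metricIn e) e.target := by
  have hφ := contMDiffOn_symm_of_mem_maximalAtlas he
  refine contDiffOn_clm_apply.2 fun v => contDiffOn_clm_apply.2 fun w => ?_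
  have hv := hφ.contMDiffOn_mfderiv_const e.open_target v
  have hw := hφ.contMDiffOn_mfderiv_const e.open_target w
  have h : ContMDiffOn (𝓡 d) ((𝓡 d).prod 𝓘(ℝ)) ∞
      (fun y => TotalSpace.mk' ℝ (E := Bundle.Trivial M ℝ) (e.symm y)
        (S.g.inner (e.symm y) (mfderiv (𝓡 d) (𝓡 d) e.symm y v)
          (mfderiv (𝓡 d) (𝓡 d) e.symm y w))) e.target := by
    apply ContMDiffOn.clm_bundle_apply₂ (F₁ := EuclideanSpace ℝ (Fin d))
      (F₂ := EuclideanSpace ℝ (Fin d))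
    · exact S.g.contMDiff.comp_contMDiffOn hφ
    · exact hv
    · exact hw
  intro y hy
  have h2 := h y hy
  simp only [contMDiffWithinAt_totalSpace] at h2
  exact h2.2.contDiffWithinAt

theorem SmoothMetricMeasure.contDiffOn_densityIn (S : SmoothMetricMeasure d M)
    {e : OpenPartialHomeomorph M (EuclideanSpace ℝ (Fin d))}
    (he : e ∈ IsManifold.maximalAtlas (𝓡 d) ∞ M) : ContDiffOn ℝ ∞ (S.densityIn e) e.target :=
  (S.f_smooth.comp_contMDiffOn (contMDiffOn_symm_of_mem_maximalAtlas he)).contDiffOn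

omit [IsManifold (𝓡 d) ∞ M] in
theorem mfderiv_symm_injective {e : OpenPartialHomeomorph M (EuclideanSpace ℝ (Fin d))}
    (he : e ∈ IsManifold.maximalAtlas (𝓡 d) ∞ M) {y : EuclideanSpace ℝ (Fin d)}
    (hy : y ∈ e.target) : Function.Injective (mfderiv (𝓡 d) (𝓡 d) e.symm y) := by
  have h1 : MDifferentiableAt (𝓡 d) (𝓡 d) e.symm y :=
    (contMDiffAt_symm_of_mem_maximalAtlas he hy).mdifferentiableAt (by simp)
  have h2 : MDifferentiableAt (𝓡 d) (𝓡 d) e (e.symm y) :=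
    (contMDiffAt_of_mem_maximalAtlas he (e.map_target hy)).mdifferentiableAt (by simp)
  have h3 := mfderiv_comp y h2 h1
  have h4 : mfderiv (𝓡 d) (𝓡 d) (e ∘ e.symm) y = ContinuousLinearMap.id ℝ _ := by
    rw [← mfderiv_id (I := 𝓡 d)]
    exact Filter.EventuallyEq.mfderiv_eq (eventually_of_mem (e.open_target.mem_nhds hy)
      fun z hz => e.right_inv hz)
  rw [h4] at h3
  intro v w hvw
  have h5 := fun z => congrArg (fun L : EuclideanSpace ℝ (Fin d) →L[ℝ] EuclideanSpace ℝ (Fin d)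
    => L z) h3
  have h6 : ∀ z : EuclideanSpace ℝ (Fin d),
      z = mfderiv (𝓡 d) (𝓡 d) e (e.symm y) (mfderiv (𝓡 d) (𝓡 d) e.symm y z) := h5
  exact (h6 v).trans ((congrArg _ hvw).trans (h6 w).symm)

theorem SmoothMetricMeasure.isMetricOn_metricIn (S : SmoothMetricMeasure d M)
    {e : OpenPartialHomeomorph M (EuclideanSpace ℝ (Fin d))}
    (he : e ∈ IsManifold.maximalAtlas (𝓡 d) ∞ M) : IsMetricOn (S.metricIn e) e.target where
  isOpen := e.open_target
  contDiffOn := S.contDiffOn_metricIn he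
  symm := fun y _ v w => by
    rw [S.metricIn_apply, S.metricIn_apply, S.g.symm]
  inv := fun y hy => isInvertible_of_nondegenerate fun v hv => by
    by_contra hv0
    have h1 : mfderiv (𝓡 d) (𝓡 d) e.symm y v ≠ 0 := fun h =>
      hv0 (mfderiv_symm_injective he hy (h.trans (map_zero (mfderiv (𝓡 d) (𝓡 d) e.symm y)).symm))
    have h2 := S.g.pos _ _ h1
    rw [← S.metricIn_apply, hv] at h2
    exact lt_irrefl _ h2

/-- On a locally conformally flat space the Riemann tensor is the Kulkarni-Nomizu product of the
weighted Schouten tensor and the metric, and the weighted Schouten tensor is a Codazzi tensor. -/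
theorem SmoothMetricMeasure.IsLocallyConformallyFlat.structure_equations (hd : 3 ≤ d)
    {S : SmoothMetricMeasure d M} (hS : S.IsLocallyConformallyFlat)
    {e : OpenPartialHomeomorph M (EuclideanSpace ℝ (Fin d))}
    (he : e ∈ IsManifold.maximalAtlas (𝓡 d) ∞ M) :
    IsCodazziOn (S.metricIn e) (schouten (S.metricIn e) (S.densityIn e) S.m S.μ) e.target ∧
      ∀ y ∈ e.target, curvature (S.metricIn e) y
        = knOp (S.metricIn e y) (schouten (S.metricIn e) (S.densityIn e) S.m S.μ y)
          (sharp (S.metricIn e) (schouten (S.metricIn e) (S.densityIn e) S.m S.μ) y) := by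
  have hG := S.isMetricOn_metricIn he
  have hf : ∀ y ∈ e.target, ContDiffAt ℝ ∞ (S.densityIn e) y := fun y hy =>
    (S.contDiffOn_densityIn he).contDiffAt (e.open_target.mem_nhds hy)
  have hf0 : ∀ y ∈ e.target, S.densityIn e y ≠ 0 := fun y _ => (S.f_pos _).ne'
  have hrank : Module.finrank ℝ (EuclideanSpace ℝ (Fin d)) = d := finrank_euclideanSpace_fin
  have hd3 : (3 : ℝ) ≤ d := by exact_mod_cast hd
  have hm := S.m_nonneg
  suffices h : (∀ y ∈ e.target, ∀ u v w, covDerivBilin (S.metricIn e)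
      (schouten (S.metricIn e) (S.densityIn e) S.m S.μ) y u v w = covDerivBilin (S.metricIn e)
      (schouten (S.metricIn e) (S.densityIn e) S.m S.μ) y v u w) ∧
      ∀ y ∈ e.target, curvature (S.metricIn e) y
        = knOp (S.metricIn e y) (schouten (S.metricIn e) (S.densityIn e) S.m S.μ y)
          (sharp (S.metricIn e) (schouten (S.metricIn e) (S.densityIn e) S.m S.μ) y) from
    ⟨⟨fun y hy => contDiffAt_schouten S.m S.μ (hG.contDiffAt hy) (hG.inv y hy) (hf y hy)
      (hf0 y hy), fun y hy => hG.schouten_symm hy S.m S.μ (hf y hy), h.1⟩, h.2⟩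
  rcases hS with (h | h) | ⟨h, hC⟩ | ⟨-, -, h3, hW⟩
  -- The cases `d + m = 1` and `d + m = 2` contradict `d ≥ 3`, `m ≥ 0`.
  · linarith
  · linarith
  · have hm0 : S.m = 0 := by linarith
    have hdd : d = 3 := by
      have : (d : ℝ) = 3 := by linarith
      exact_mod_cast this
    refine ⟨fun y hy u v w => sub_eq_zero.1 (hC e he y hy u v w), fun y hy => ?_⟩
    rw [hm0]
    exact hG.curvature_eq_knOp_of_finrank_eq_three hy S.μ (hrank.trans hdd) (hf y hy)
  · have hR : ∀ y ∈ e.target, curvature (S.metricIn e) y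
        = knOp (S.metricIn e y) (schouten (S.metricIn e) (S.densityIn e) S.m S.μ y)
          (sharp (S.metricIn e) (schouten (S.metricIn e) (S.densityIn e) S.m S.μ) y) :=
      fun y hy => hG.curvature_eq_knOp hy fun u v z w => sub_eq_zero.1 (hW e he y hy u v z w)
    refine ⟨fun y hy => hG.schouten_codazzi hy (hrank.symm ▸ hd) hm ?_ hf hf0 hR, hR⟩
    rw [hrank]
    -- The pair `d = 3`, `m = 0` not covered by `schouten_codazzi` would give `d + m = 3`.
    by_contra! hcon
    apply h3
    have hd' : (d : ℝ) = 3 := by exact_mod_cast hcon.1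
    rw [hd', hcon.2, add_zero]

end Manifold

end WeightedAmbient

end

/-- Over every smooth chart `e` of `M`: `g̃` is a flat metric; `U` is invertible wherever `g_ρ` is
nondegenerate; and, with `G`, `f` the coordinate expressions of `g` and the density, `V = U⁻¹` and
`P` the weighted Schouten tensor, one has
`(∇^{g_ρ}_i η)_j = (∇^g_i η)_j - ρ V^k_l P^l_{i;j} η_k` and
`Rm^{g_ρ}_{ijkl} = Rm^g_{abkl} U^a_i U^b_j`. -/
theorem mainTheorem5 {d : ℕ} (hd : 3 ≤ d) {M : Type*} [TopologicalSpace M]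
    [ChartedSpace (EuclideanSpace ℝ (Fin d)) M] [IsManifold (𝓡 d) ∞ M]
    (S : WeightedAmbient.SmoothMetricMeasure d M) (hS : S.IsLocallyConformallyFlat)
    (e : OpenPartialHomeomorph M (EuclideanSpace ℝ (Fin d)))
    (he : e ∈ IsManifold.maximalAtlas (𝓡 d) ∞ M)
    (G : EuclideanSpace ℝ (Fin d) →
      EuclideanSpace ℝ (Fin d) →L[ℝ] EuclideanSpace ℝ (Fin d) →L[ℝ] ℝ)
    (hG : G = S.metricIn e)
    (f : EuclideanSpace ℝ (Fin d) → ℝ) (hf : f = S.densityIn e) :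
    WeightedAmbient.IsFlatMetricOn (WeightedAmbient.ambientMetric G f S.m S.μ)
        (S.ambientDomainIn e) ∧
    ∀ (ρ : ℝ), ∀ p ∈ e.target, (WeightedAmbient.gRho G f S.m S.μ ρ p).IsInvertible →
      (WeightedAmbient.U G f S.m S.μ ρ p).IsInvertible ∧
      (∀ (η : EuclideanSpace ℝ (Fin d) → EuclideanSpace ℝ (Fin d) →L[ℝ] ℝ)
          (v w : EuclideanSpace ℝ (Fin d)), DifferentiableAt ℝ η p →
        WeightedAmbient.covDerivForm (WeightedAmbient.gRho G f S.m S.μ ρ) η p v w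
          = WeightedAmbient.covDerivForm G η p v w
            - ρ * η p ((WeightedAmbient.U G f S.m S.μ ρ p).inverse
                ((G p).inverse (WeightedAmbient.covDerivBilin G
                  (WeightedAmbient.schouten G f S.m S.μ) p w v)))) ∧
      (∀ v w z y : EuclideanSpace ℝ (Fin d),
        WeightedAmbient.Rm (WeightedAmbient.gRho G f S.m S.μ ρ) p v w z y
          = WeightedAmbient.Rm G p (WeightedAmbient.U G f S.m S.μ ρ p v)
              (WeightedAmbient.U G f S.m S.μ ρ p w) z y) := by
  subst hG hf
  have hM := S.isMetricOn_metricIn he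
  obtain ⟨hP, hR⟩ := hS.structure_equations hd he
  refine ⟨WeightedAmbient.isFlatMetricOn_ambientMetric hM hP hR, fun ρ p hp hρ =>
    ⟨WeightedAmbient.isInvertible_U hM hP hp hρ, fun η v w _ =>
      WeightedAmbient.covDerivForm_gRho hM hP hp hρ η v w, fun v w z y =>
      WeightedAmbient.Rm_gRho hM hP hp hρ v w z y⟩⟩
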